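/- Let $k\ge 1$ and $0\le\Delta<d$ be integers. Let $\mathbb H^d=(\mathbb R\cup\{\otimes\})^d$, where $\otimes$ is a missing entry, let $\mathrm{dom}(x)=\{i: x_i\ne\otimes\}$, and call $x$ $\Delta$-missing if at most $\Delta$ of its entries are $\otimes$. For $I\subseteq[d]$ let $d_I(x,y)^2=\sum_{i\in I}|x_i-y_i|^2$, with $|a-b|=0$ if $a$ or $b$ is $\otimes$, and $\mathrm{cost}_I(Q,y)=\sum_{x\in Q}d_I(x,y)^2$; write $\mathrm{cost}=\mathrm{cost}_{[d]}$, $\mathrm{cost}_i=\mathrm{cost}_{\{i\}}$, and let distances without index be on $[d]$. For $Q\subseteq\mathbb H^d$ let $\mathrm{FD}(Q,I)=\{x\in Q:\mathrm{dom}(x)\subseteq I\}$ and $\mathrm{PD}(Q,I)=\{x\in Q:\mathrm{dom}(x)\cap I\neq\emptyset\}$; the centroid $c(Q)$ has as $i$-th entry the mean of the $i$-th entries of $\mathrm{PD}(Q,\{i\})$ ($\otimes$ if this set is empty). A $k$-means clustering of a finite set $P$ is a partition $(P_t)_{t\in[k]}$ of $P$ into possibly empty clusters with centers $c_t\in\mathbb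 R^d$; its cost is $\sum_t\mathrm{cost}(P_t,c_t)$, and it is $\rho$-approximate if this is at most $\rho$ times the minimum cost $\mathrm{opt}_k(P)$. Let $P$ be a finite set of $\Delta$-missing points of $\mathbb H^d$, let $(P^*_t)_{t\in[k]}$ be the clusters of an optimal $k$-means clustering of $P$, let $\alpha>0$, and let $c>0$ satisfy $4\cdot 2^k c k\le 1$. Let two randomized sampling procedures (with discrete output distributions and fresh randomness at each call) be given. - The point sampler maps a finite set $R$ of points to a random $\Delta$-missing point $u$. Its success probability $p$ is the infimum, over all nonempty finite sets $R$ of $\Delta$-missing points and all $Q\subseteq R$ with $|Q|\ge c|R|$, of the probability that $\mathrm{cost}_I(Q,u)\le(1+\alpha)\,\mathrm{cost}_I(Q,c(Q))$, where $I=\mathrm{dom}(u)$. - The value sampler maps a finite set $R$ of points and $i\in[d]$ to a random $x\in\mathbb R$. Its success probability $q$ is the infimum, over all nonempty finite $R\subset\mathbb H^d$, all $i\in[d]$ and all $Q\subseteq R$ with $|\mathrm{PD}(Q,\{i\})|\ge\frac{c}{\Delta}|R|$, of the probability that $\mathrm{cost}_i(Q,x)\le(1+\alpha)\,\mathrm{cost}_i(Q,c(Q))$.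 (For $\Delta=0$ this sampler is never called and $q$ does not matter.) Idealized $k$-means, with access to the numbers $|Q\cap P^*_t|$ for $Q\subseteq P$ (counting oracle), works as follows. Start with $R=P$, $P_t=\emptyset$ and $u_t=(\otimes,\dots,\otimes)$ for all $t\in[k]$; write $I_t=\mathrm{dom}(u_t)$. While $R\neq\emptyset$, choose $t$ maximizing $|\mathrm{PD}(R\cap P^*_t,[d]\setminus I_t)|$. - Sampling phase, if this number is at least $c|R|$: if $I_t=\emptyset$, replace $u_t$ by the output of the point sampler on $R$; otherwise choose $j\in[d]\setminus I_t$ maximizing $|\mathrm{PD}(R\cap P_t^*,\{j\})|$ and set $(u_t)_j$ to the output of the value sampler on $(R,j)$. Then add each point of $\mathrm{FD}(R,\bigcap_{t'}I_{t'})$ to the cluster $P_{t'}$ of a closest center $u_{t'}$, and remove these points from $R$. - Pruning phase, otherwise: for $T\subseteq[k]$ let $S_T$ be the set of $x\in R$ such that, for every $t\in[k]$, $\mathrm{dom}(x)\subseteq I_t$ if and only if $t\in T$. Choose a proper subset $T$ of $[k]$ maximizing $|S_T|$, let $B$ be the first $\lceil |S_T|/2\rceil$ points of $S_T$ in ascending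 order of the distance to the closest of the centers $u_t$, $t\in T$, add each point of $B$ to the cluster of a closest center among these, and remove $B$ from $R$. Then, however ties are broken, the procedure always terminates, after at most $k(\Delta+1)+|P|$ phases. With probability at least $p^kq^{k\Delta}$, the resulting clusters $(P_t)_{t\in[k]}$, together with the centers obtained from $(u_t)_{t\in[k]}$ by filling in any remaining missing entries with arbitrary real numbers, form a $\bigl(1+8\cdot 2^k c k^2(\Delta+1)^2\bigr)(1+\alpha)$-approximate $k$-means clustering of $P$. -/

import Mathlib

open scoped ENNReal

namespace MissingKMeans

noncomputable section

/-- Points of `ℝ^d` some of whose coordinates may be missing; a missing entry is `none`. -/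
abbrev HPoint (d : ℕ) : Type := Fin d → Option ℝ

variable {d k : ℕ}

/-- The set of coordinates at which `u` is defined. -/
def dom (u : HPoint d) : Finset (Fin d) := Finset.univ.filter fun i => u i ≠ none

/-- At most `Δ` coordinates are missing. -/
def IsMissing (Δ : ℕ) (u : HPoint d) : Prop :=
  (Finset.univ.filter fun i => u i = none).card ≤ Δ

/-- The point all of whose coordinates are missing. -/
def nullPoint : HPoint d := fun _ => none

/-- An ordinary point of `ℝ^d`, seen as a point without missing entries. -/
def full (c : Fin d → ℝ) : HPoint d := fun i => some (c i)

/-- The points of `P` that are fully defined on `I`. -/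
def FD (P : Finset (HPoint d)) (I : Finset (Fin d)) : Finset (HPoint d) :=
  P.filter fun x => dom x ⊆ I

/-- The points of `P` that are partially defined on `I`. -/
def PD (P : Finset (HPoint d)) (I : Finset (Fin d)) : Finset (HPoint d) :=
  P.filter fun x => (dom x ∩ I).Nonempty

/-- `|a - b|`, with value `0` if one of the two entries is missing. -/
def gap : Option ℝ → Option ℝ → ℝ
  | some a, some b => |a - b|
  | _, _ => 0

/-- The distance of `x` and `y` on the coordinate set `I`. -/
def distOn (I : Finset (Fin d)) (x y : HPoint d) : ℝ :=
  Real.sqrt (∑ i ∈ I, gap (x i) (y i) ^ 2)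

/-- The sum of the squared distances on `I` of the points of `P` to `y`. -/
def costOn (I : Finset (Fin d)) (P : Finset (HPoint d)) (y : HPoint d) : ℝ :=
  ∑ x ∈ P, distOn I x y ^ 2

/-- The cost on all coordinates. -/
def cost (P : Finset (HPoint d)) (y : HPoint d) : ℝ := costOn Finset.univ P y

/-- The centroid; its `i`-th entry is missing if no point of `P` is defined at `i`. -/
def centroid (P : Finset (HPoint d)) : HPoint d := fun i =>
  if PD P {i} = ∅ then none
  else some ((∑ u ∈ PD P {i}, (u i).getD 0) / ((PD P {i}).card : ℝ))

/-- `A` is a partition of `P` into `k` (possibly empty) clusters. -/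
def IsPartition (P : Finset (HPoint d)) (A : Fin k → Finset (HPoint d)) : Prop :=
  (∀ t t', t ≠ t' → Disjoint (A t) (A t')) ∧ Finset.univ.biUnion A = P

/-- The cost of the clustering with clusters `A t` and centers `C t` in `ℝ^d`. -/
def clusteringCost (A : Fin k → Finset (HPoint d)) (C : Fin k → Fin d → ℝ) : ℝ :=
  ∑ t, cost (A t) (full (C t))

/-- `(A, C)` is a `k`-means clustering of `P` whose cost is at most `ρ` times the cost of every
`k`-means clustering of `P`. -/
def IsApproxKMeans (ρ : ℝ) (P : Finset (HPoint d))
    (A : Fin k → Finset (HPoint d)) (C : Fin k → Fin d → ℝ) : Prop :=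
  IsPartition P A ∧ ∀ (A' : Fin k → Finset (HPoint d)) (C' : Fin k → Fin d → ℝ),
    IsPartition P A' → clusteringCost A C ≤ ρ * clusteringCost A' C'

/-- An optimal `k`-means clustering of `P`. -/
def IsOptimalKMeans (P : Finset (HPoint d))
    (A : Fin k → Finset (HPoint d)) (C : Fin k → Fin d → ℝ) : Prop :=
  IsApproxKMeans 1 P A C

/-- `C` is obtained from `U` by filling in the missing entries with arbitrary reals. -/
def Completes (U : Fin k → HPoint d) (C : Fin k → Fin d → ℝ) : Prop :=
  ∀ t i a, U t i = some a → C t i = a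

/-! ### The two sampling procedures -/

/-- A randomized procedure that maps a set of points to a random `Δ`-missing point. -/
abbrev PointSampler (d Δ : ℕ) : Type :=
  Finset (HPoint d) → PMF {u : HPoint d // IsMissing Δ u}

/-- A randomized procedure that maps a set of points and a coordinate to a random real. -/
abbrev ValueSampler (d : ℕ) : Type := Finset (HPoint d) → Fin d → PMF ℝ

/-- The success probability of a point sampler: the largest probability with which, for every
nonempty set `P` of `Δ`-missing points and every (unknown) `Q ⊆ P` with `|Q| ≥ c |P|`, the sampled
point `u` satisfies `cost_I(Q, u) ≤ (1 + α) cost_I(Q, c(Q))`, where `I` is the domain of `u`. -/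
def pointSuccess {Δ : ℕ} (c α : ℝ) (sampler : PointSampler d Δ) : ℝ≥0∞ :=
  ⨅ (P : Finset (HPoint d)) (Q : Finset (HPoint d)) (_ : P.Nonempty)
    (_ : ∀ x ∈ P, IsMissing Δ x) (_ : Q ⊆ P) (_ : c * (P.card : ℝ) ≤ (Q.card : ℝ)),
    (sampler P).toOuterMeasure
      {u | costOn (dom u.1) Q u.1 ≤ (1 + α) * costOn (dom u.1) Q (centroid Q)}

/-- The success probability of a value sampler: the largest probability with which, for every
nonempty set `P` of points, every coordinate `i` and every (unknown) `Q ⊆ P` with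
`|PD(Q, i)| ≥ c |P|`, the sampled value `x` satisfies `cost_i(Q, x) ≤ (1 + α) cost_i(Q, c(Q))`. -/
def valueSuccess (c α : ℝ) (sampler : ValueSampler d) : ℝ≥0∞ :=
  ⨅ (P : Finset (HPoint d)) (Q : Finset (HPoint d)) (i : Fin d) (_ : P.Nonempty)
    (_ : Q ⊆ P) (_ : c * (P.card : ℝ) ≤ ((PD Q {i}).card : ℝ)),
    (sampler P i).toOuterMeasure
      {x | costOn {i} Q (full fun _ => x) ≤ (1 + α) * costOn {i} Q (centroid Q)}

/-! ### The idealized algorithm -/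

/-- The data maintained by the algorithm: the unassigned points, the partial centers and the
clusters built so far. -/
structure State (k d : ℕ) where
  R : Finset (HPoint d)
  U : Fin k → HPoint d
  clusters : Fin k → Finset (HPoint d)

/-- The state before the first phase. -/
def initState (k : ℕ) (P : Finset (HPoint d)) : State k d where
  R := P
  U := fun _ => nullPoint
  clusters := fun _ => ∅

/-- `⋂ t, dom (U t)`. -/
def commonDom (U : Fin k → HPoint d) : Finset (Fin d) :=
  Finset.univ.filter fun i => ∀ t, i ∈ dom (U t)

/-- The points `x` of `R` with `dom x ⊆ dom (U t)` for exactly the `t ∈ T`. -/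
def cell (R : Finset (HPoint d)) (U : Fin k → HPoint d) (T : Finset (Fin k)) :
    Finset (HPoint d) :=
  R.filter fun x => ∀ t, dom x ⊆ dom (U t) ↔ t ∈ T

/-- `U t` is a center closest to `x` among the centers with index in `T`. -/
def IsClosest (U : Fin k → HPoint d) (T : Finset (Fin k)) (x : HPoint d) (t : Fin k) : Prop :=
  t ∈ T ∧ ∀ t' ∈ T, distOn Finset.univ x (U t) ≤ distOn Finset.univ x (U t')

/-- Add every point `x` of `B` to the cluster with index `a x`. -/
def assign (A : Fin k → Finset (HPoint d)) (B : Finset (HPoint d)) (a : HPoint d → Fin k) :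
    Fin k → Finset (HPoint d) :=
  fun t => A t ∪ B.filter fun x => a x = t

/-- `B` is the first half (rounded up) of `S` in some ordering of `S` by ascending distance to the
closest of the centers with index in `T`. -/
def IsFirstHalf (U : Fin k → HPoint d) (T : Finset (Fin k)) (S B : Finset (HPoint d)) : Prop :=
  B ⊆ S ∧ B.card = (S.card + 1) / 2 ∧
    ∀ x ∈ B, ∀ y ∈ S \ B, ∀ t' ∈ T, ∃ t ∈ T,
      distOn Finset.univ x (U t) ≤ distOn Finset.univ y (U t')

/-- The number `|PD(R ∩ P*_t, [d] - I_t)|`, obtained from the counting oracle of the clustering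
`Pstar`. -/
def openCount (Pstar : Fin k → Finset (HPoint d)) (s : State k d) (t : Fin k) : ℕ :=
  (PD (s.R ∩ Pstar t) (Finset.univ \ dom (s.U t))).card

/-- `s'` is a possible end of a sampling phase that began in `s` and changed the centers to `U'`:
the points fully defined on all centers are assigned to a closest center. -/
def EndOfSampling (s : State k d) (U' : Fin k → HPoint d) (s' : State k d) : Prop :=
  ∃ a : HPoint d → Fin k,
    (∀ x ∈ FD s.R (commonDom U'), IsClosest U' Finset.univ x (a x)) ∧
    s' = { R := s.R \ FD s.R (commonDom U')
           U := U'
           clusters := assign s.clusters (FD s.R (commonDom U')) a }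

/-- `Phase Pstar c ps vs s μ`: one iteration of the loop, begun in the state `s`, may lead to the
random state `μ`. Every way of breaking the ties of the algorithm gives such a `μ`. -/
inductive Phase {Δ : ℕ} (Pstar : Fin k → Finset (HPoint d)) (c : ℝ)
    (ps : PointSampler d Δ) (vs : ValueSampler d) (s : State k d) : PMF (State k d) → Prop
  /-- sampling phase for a center that is still the null point -/
  | samplePoint (t : Fin k) (g : {u : HPoint d // IsMissing Δ u} → State k d)
      (ht : ∀ t', openCount Pstar s t' ≤ openCount Pstar s t)
      (hc : c * (s.R.card : ℝ) ≤ (openCount Pstar s t : ℝ))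
      (hI : dom (s.U t) = ∅)
      (hg : ∀ u, EndOfSampling s (Function.update s.U t u.1) (g u)) :
      Phase Pstar c ps vs s ((ps s.R).map g)
  /-- sampling phase for one more coordinate of a center -/
  | sampleValue (t : Fin k) (j : Fin d) (g : ℝ → State k d)
      (ht : ∀ t', openCount Pstar s t' ≤ openCount Pstar s t)
      (hc : c * (s.R.card : ℝ) ≤ (openCount Pstar s t : ℝ))
      (hI : dom (s.U t) ≠ ∅)
      (hj : j ∉ dom (s.U t))
      (hmax : ∀ i, i ∉ dom (s.U t) →
        (PD (s.R ∩ Pstar t) {i}).card ≤ (PD (s.R ∩ Pstar t) {j}).card)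
      (hg : ∀ x, EndOfSampling s
        (Function.update s.U t (Function.update (s.U t) j (some x))) (g x)) :
      Phase Pstar c ps vs s ((vs s.R j).map g)
  /-- pruning phase -/
  | prune (T : Finset (Fin k)) (B : Finset (HPoint d)) (a : HPoint d → Fin k)
      (hc : ∀ t, (openCount Pstar s t : ℝ) < c * (s.R.card : ℝ))
      (hT : T ≠ Finset.univ)
      (hmax : ∀ T' : Finset (Fin k), T' ≠ Finset.univ →
        (cell s.R s.U T').card ≤ (cell s.R s.U T).card)
      (hB : IsFirstHalf s.U T (cell s.R s.U T) B)
      (ha : ∀ x ∈ B, IsClosest s.U T x (a x)) :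
      Phase Pstar c ps vs s
        (PMF.pure { R := s.R \ B, U := s.U, clusters := assign s.clusters B a })

/-- A complete rule for carrying out the phases, i.e. the algorithm together with a way of breaking
its ties. -/
def IsPhaseRule {Δ : ℕ} (Pstar : Fin k → Finset (HPoint d)) (c : ℝ)
    (ps : PointSampler d Δ) (vs : ValueSampler d) (next : State k d → PMF (State k d)) : Prop :=
  ∀ s, s.R.Nonempty → (∃ μ, Phase Pstar c ps vs s μ) → Phase Pstar c ps vs s (next s)

/-- At most `n` iterations of the loop `while R ≠ ∅`. -/
def loop (next : State k d → PMF (State k d)) : ℕ → State k d → PMF (State k d)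
  | 0, s => PMF.pure s
  | n + 1, s => if s.R = ∅ then PMF.pure s else (next s).bind (loop next n)

end

end MissingKMeans

open MissingKMeans

namespace MissingKMeans

variable {d k : ℕ}

/-! ### Distances and costs -/

/-! Termination: a sampling phase raises the rank of a center, a pruning phase removes a point, and
a phase is always available (`exists_phase`). Ranks are at most `Δ + 1`, so the number of unassigned
points minus the total rank can only drop `k * (Δ + 1) + P.card` times.

Quality of the centers: a good sample is nearly optimal for the unassigned part of its optimal
cluster. Points of that cluster assigned earlier while settled have no entry in the new coordinates,
so they add nothing. Hence the settled points, measured to the centers of their optimal clusters,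
cost at most `(1 + α)` times the optimum (`Accounted.sum_optDist_le`).

Cost of the assignment: a settled point is assigned at no more than this distance, so only misplaced
points, assigned by pruning, need an argument. They form at most a fraction `e = 2 ^ k * c * (k - 1)
< 1 / 4` of the pruned cell, and since the nearest half is taken, they are no farther away than the
settled points left in the cell. Charging those points afresh in each pruning phase would lose a
factor for the number of phases. Instead `lam T` records a distance already charged: only its
increase is charged to the points left behind, and the rest to settled points leaving now
(`Accounted.prune`). Sampling changes the cells and resets `lam`; this costs one charge of the
settled distances per unit of rank (`Accounted.endOfSampling`). The total factor is `1 + 9 * e + 5 *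
e * k * (Δ + 1)`.

Probability: `weight`, the product of the success probabilities of all samples still needed, bounds
the chance of a successful run from below, by induction over the loop (`weight_le_loop`). -/

lemma mem_dom {u : HPoint d} {i : Fin d} : i ∈ dom u ↔ u i ≠ none := by simp [dom]

lemma gap_none_left (b : Option ℝ) : gap none b = 0 := by cases b <;> rfl

lemma gap_none_right (a : Option ℝ) : gap a none = 0 := by cases a <;> rfl

lemma distOn_sq (I : Finset (Fin d)) (x y : HPoint d) :
    distOn I x y ^ 2 = ∑ i ∈ I, gap (x i) (y i) ^ 2 :=
  Real.sq_sqrt (Finset.sum_nonneg fun _ _ => sq_nonneg _)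

/-- The squared distance of two points. -/
noncomputable def sqDist (x y : HPoint d) : ℝ := distOn Finset.univ x y ^ 2

lemma sqDist_nonneg (x y : HPoint d) : 0 ≤ sqDist x y := sq_nonneg _

lemma sqDist_le_sqDist {x y x' y' : HPoint d}
    (h : distOn Finset.univ x y ≤ distOn Finset.univ x' y') : sqDist x y ≤ sqDist x' y' :=
  pow_le_pow_left₀ (Real.sqrt_nonneg _) h 2

lemma sqDist_eq_distOn_dom (x u : HPoint d) : sqDist x u = distOn (dom u) x u ^ 2 := by
  rw [sqDist, distOn_sq, distOn_sq]
  refine (Finset.sum_subset (Finset.subset_univ _) fun i _ hi => ?_).symm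
  have : u i = none := by simpa [mem_dom] using hi
  simp [this, gap_none_right]

/-- Missing entries of `x` contribute nothing, so once `x` is fully defined on a center, extending
the center leaves their distance fixed. This freezes the cost of assigned points. -/
lemma sqDist_congr_of_dom_subset {x u v : HPoint d} (hx : dom x ⊆ dom u)
    (h : ∀ i ∈ dom u, v i = u i) : sqDist x v = sqDist x u := by
  rw [sqDist, sqDist, distOn_sq, distOn_sq]
  refine Finset.sum_congr rfl fun i _ => ?_
  by_cases hi : i ∈ dom x
  · rw [h i (hx hi)]
  · have : x i = none := by simpa [mem_dom] using hi
    simp [this, gap_none_left]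

lemma costOn_nonneg (I : Finset (Fin d)) (Q : Finset (HPoint d)) (y : HPoint d) :
    0 ≤ costOn I Q y := Finset.sum_nonneg fun _ _ => sq_nonneg _

lemma costOn_eq_sum (I : Finset (Fin d)) (Q : Finset (HPoint d)) (y : HPoint d) :
    costOn I Q y = ∑ i ∈ I, costOn {i} Q y := by
  simp only [costOn, distOn_sq, Finset.sum_singleton]
  exact Finset.sum_comm

lemma costOn_mono_set (I : Finset (Fin d)) {Q Q' : Finset (HPoint d)} (h : Q ⊆ Q')
    (y : HPoint d) : costOn I Q y ≤ costOn I Q' y :=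
  Finset.sum_le_sum_of_subset_of_nonneg h fun _ _ _ => sq_nonneg _

lemma costOn_mono_coords {I J : Finset (Fin d)} (h : I ⊆ J) (Q : Finset (HPoint d))
    (y : HPoint d) : costOn I Q y ≤ costOn J Q y := by
  rw [costOn_eq_sum I, costOn_eq_sum J]
  exact Finset.sum_le_sum_of_subset_of_nonneg h fun _ _ _ => costOn_nonneg _ _ _

lemma costOn_congr {I : Finset (Fin d)} {y z : HPoint d} (h : ∀ i ∈ I, y i = z i)
    (Q : Finset (HPoint d)) : costOn I Q y = costOn I Q z := by
  refine Finset.sum_congr rfl fun x _ => ?_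
  rw [distOn_sq, distOn_sq]
  exact Finset.sum_congr rfl fun i hi => by rw [h i hi]

lemma mem_PD_singleton {Q : Finset (HPoint d)} {i : Fin d} {x : HPoint d} :
    x ∈ PD Q {i} ↔ x ∈ Q ∧ i ∈ dom x := by
  simp [PD, Finset.Nonempty, and_comm]

lemma costOn_singleton_eq (Q : Finset (HPoint d)) (i : Fin d) {y : HPoint d} {a : ℝ}
    (h : y i = some a) :
    costOn {i} Q y = ∑ x ∈ PD Q {i}, ((x i).getD 0 - a) ^ 2 := by
  simp only [costOn, distOn_sq, Finset.sum_singleton, h]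
  have hsub : PD Q {i} ⊆ Q := Finset.filter_subset _ _
  rw [← Finset.sum_subset hsub]
  · refine Finset.sum_congr rfl fun x hx => ?_
    obtain ⟨b, hb⟩ := Option.ne_none_iff_exists'.1 (mem_dom.1 (mem_PD_singleton.1 hx).2)
    simp [hb, gap]
  · intro x hx hx'
    have : x i = none := by
      by_contra hne
      exact hx' (mem_PD_singleton.2 ⟨hx, mem_dom.2 hne⟩)
    simp [this, gap_none_left]

lemma sum_sq_sub_mean_le {ι : Type*} (S : Finset ι) (f : ι → ℝ) (a : ℝ) :
    ∑ x ∈ S, (f x - (∑ y ∈ S, f y) / S.card) ^ 2 ≤ ∑ x ∈ S, (f x - a) ^ 2 := by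
  rcases S.eq_empty_or_nonempty with rfl | hS
  · simp
  have hn : (S.card : ℝ) ≠ 0 := by exact_mod_cast hS.card_pos.ne'
  set m : ℝ := (∑ y ∈ S, f y) / S.card with hm
  have hsum : ∑ x ∈ S, (f x - m) = 0 := by
    rw [Finset.sum_sub_distrib, Finset.sum_const, nsmul_eq_mul, hm]
    field_simp
    simp
  have : ∑ x ∈ S, (f x - a) ^ 2 =
      ∑ x ∈ S, (f x - m) ^ 2 + 2 * (m - a) * ∑ x ∈ S, (f x - m) + S.card * (m - a) ^ 2 := by
    rw [Finset.mul_sum, ← nsmul_eq_mul, ← Finset.sum_const, ← Finset.sum_add_distrib,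
      ← Finset.sum_add_distrib]
    exact Finset.sum_congr rfl fun x _ => by ring
  rw [this, hsum]
  have : 0 ≤ (S.card : ℝ) * (m - a) ^ 2 := by positivity
  linarith

/-- Costs split over coordinates, and on each the mean minimizes the sum of squares. Where the
centroid is missing, no point of `Q` has an entry either. -/
lemma costOn_centroid_le (I : Finset (Fin d)) (Q : Finset (HPoint d)) (y : Fin d → ℝ) :
    costOn I Q (centroid Q) ≤ costOn I Q (full y) := by
  rw [costOn_eq_sum I, costOn_eq_sum I]
  refine Finset.sum_le_sum fun i _ => ?_
  rw [costOn_singleton_eq Q i (y := full y) (a := y i) rfl]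
  by_cases h : PD Q {i} = ∅
  · have h0 : centroid Q i = none := by simp [centroid, h]
    have : costOn {i} Q (centroid Q) = 0 := by
      simp [costOn, distOn_sq, h0, gap_none_right]
    rw [this]
    exact Finset.sum_nonneg fun _ _ => sq_nonneg _
  · rw [costOn_singleton_eq Q i (y := centroid Q)
      (a := (∑ u ∈ PD Q {i}, (u i).getD 0) / ((PD Q {i}).card : ℝ)) (by simp [centroid, h])]
    exact sum_sq_sub_mean_le (PD Q {i}) (fun u => (u i).getD 0) (y i)

lemma cost_eq_sum_sqDist (Q : Finset (HPoint d)) (y : HPoint d) :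
    cost Q y = ∑ x ∈ Q, sqDist x y := rfl

lemma card_dom_add_card_missing (u : HPoint d) :
    (dom u).card + (Finset.univ.filter fun i => u i = none).card = d := by
  have := Finset.card_filter_add_card_filter_not (s := (Finset.univ : Finset (Fin d)))
    (fun i => u i ≠ none)
  simpa [dom] using this

lemma IsMissing.le_card_dom_add {Δ : ℕ} {u : HPoint d} (h : IsMissing Δ u) :
    d ≤ (dom u).card + Δ := by
  have := card_dom_add_card_missing u
  unfold IsMissing at h
  omega

lemma IsMissing.dom_nonempty {Δ : ℕ} (hΔ : Δ < d) {u : HPoint d} (h : IsMissing Δ u) :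
    (dom u).Nonempty := by
  rw [← Finset.card_pos]
  have := h.le_card_dom_add
  omega

lemma dom_update (u : HPoint d) (j : Fin d) (x : ℝ) :
    dom (Function.update u j (some x)) = insert j (dom u) := by
  ext i
  by_cases h : i = j
  · subst h; simp [mem_dom]
  · simp [mem_dom, h]

/-- `v` has the same entries as `u` wherever `u` is defined. -/
def Extends (u v : HPoint d) : Prop := ∀ i ∈ dom u, v i = u i

lemma Extends.dom_subset {u v : HPoint d} (h : Extends u v) : dom u ⊆ dom v := fun i hi =>
  mem_dom.2 (by rw [h i hi]; exact mem_dom.1 hi)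

lemma extends_of_dom_eq_empty {u v : HPoint d} (h : dom u = ∅) : Extends u v := by
  simp [Extends, h]

lemma extends_update {u : HPoint d} {j : Fin d} (hj : j ∉ dom u) (x : ℝ) :
    Extends u (Function.update u j (some x)) := fun i hi => by
  rw [Function.update_of_ne]
  rintro rfl
  exact hj hi

lemma extends_update_center {U : Fin k → HPoint d} {t : Fin k} {u : HPoint d}
    (h : Extends (U t) u) (t' : Fin k) : Extends (U t') (Function.update U t u t') := by
  by_cases ht : t' = t
  · subst ht; simpa using h
  · simp [Extends, Function.update_of_ne ht]

/-! ### Progress of the partial centers -/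

/-- An upper bound for the number of sampling phases that led to the partial center `u`. -/
def rank (Δ : ℕ) (u : HPoint d) : ℕ :=
  if dom u = ∅ then 0 else (dom u).card + Δ + 1 - d

lemma rank_le (Δ : ℕ) (u : HPoint d) : rank Δ u ≤ Δ + 1 := by
  have := card_dom_add_card_missing u
  unfold rank
  split_ifs <;> omega

/-- The sum of the ranks of the centers. -/
def totalRank (Δ : ℕ) (U : Fin k → HPoint d) : ℕ := ∑ t, rank Δ (U t)

lemma totalRank_le (Δ : ℕ) (U : Fin k → HPoint d) : totalRank Δ U ≤ k * (Δ + 1) := by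
  simpa [totalRank] using Finset.sum_le_card_nsmul (Finset.univ : Finset (Fin k)) (fun t => rank Δ (U t))
    (Δ + 1) (fun t _ => rank_le Δ (U t))

lemma sum_update_eq {M : Type*} [AddCommMonoid M] (f : HPoint d → M) (U : Fin k → HPoint d)
    (t : Fin k) (u : HPoint d) :
    ∑ t', f (Function.update U t u t') = f u + ∑ t' ∈ Finset.univ.erase t, f (U t') := by
  rw [← Finset.add_sum_erase _ _ (Finset.mem_univ t), Function.update_self]
  congr 1
  exact Finset.sum_congr rfl fun t' ht' => by
    rw [Function.update_of_ne (Finset.ne_of_mem_erase ht')]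

lemma totalRank_lt_update {Δ : ℕ} {U : Fin k → HPoint d} {t : Fin k} {u : HPoint d}
    (h : rank Δ (U t) < rank Δ u) : totalRank Δ U < totalRank Δ (Function.update U t u) := by
  rw [totalRank, totalRank, sum_update_eq, ← Finset.add_sum_erase _ _ (Finset.mem_univ t)]
  omega

/-- A `Δ`-missing point has at least `d - Δ` entries, so its rank is at least 1. -/
lemma rank_lt_of_dom_eq_empty {Δ : ℕ} (hΔ : Δ < d) {u v : HPoint d} (hu : dom u = ∅)
    (hv : IsMissing Δ v) : rank Δ u < rank Δ v := by
  have := hv.le_card_dom_add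
  simp only [rank, hu, (hv.dom_nonempty hΔ).ne_empty, if_true, if_false]
  omega

lemma rank_lt_update {Δ : ℕ} {u : HPoint d} (hu : d ≤ (dom u).card + Δ) (hne : dom u ≠ ∅)
    {j : Fin d} (hj : j ∉ dom u) (x : ℝ) :
    rank Δ u < rank Δ (Function.update u j (some x)) := by
  simp only [rank, hne, dom_update, if_false, Finset.insert_ne_empty,
    Finset.card_insert_of_notMem hj]
  omega

/-! ### Clusters, cells and counts -/

/-- `τ` gives for each point of `P` the index of its cluster in `Pstar`. -/
def IsLabel (P : Finset (HPoint d)) (Pstar : Fin k → Finset (HPoint d))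
    (τ : HPoint d → Fin k) : Prop :=
  ∀ x t, x ∈ Pstar t ↔ x ∈ P ∧ τ x = t

lemma IsPartition.exists_isLabel (hk : 1 ≤ k) {P : Finset (HPoint d)}
    {Pstar : Fin k → Finset (HPoint d)} (h : IsPartition P Pstar) :
    ∃ τ, IsLabel P Pstar τ := by
  classical
  have hex : ∀ x, ∃ t, x ∈ P → x ∈ Pstar t := fun x => by
    by_cases hx : x ∈ P
    · rw [← h.2] at hx
      obtain ⟨t, -, ht⟩ := Finset.mem_biUnion.1 hx
      exact ⟨t, fun _ => ht⟩
    · exact ⟨⟨0, hk⟩, fun h => absurd h hx⟩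
  choose τ hτ using hex
  refine ⟨τ, fun x t => ⟨fun hx => ?_, fun hx => hx.2 ▸ hτ x hx.1⟩⟩
  have hxP : x ∈ P := by
    rw [← h.2]
    exact Finset.mem_biUnion.2 ⟨t, Finset.mem_univ _, hx⟩
  refine ⟨hxP, ?_⟩
  by_contra hne
  exact Finset.disjoint_left.1 (h.1 _ _ hne) (hτ x hxP) hx

/-- The centers on whose domain `x` is fully defined. -/
def index (U : Fin k → HPoint d) (x : HPoint d) : Finset (Fin k) :=
  Finset.univ.filter fun t => dom x ⊆ dom (U t)

lemma mem_index {U : Fin k → HPoint d} {x : HPoint d} {t : Fin k} :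
    t ∈ index U x ↔ dom x ⊆ dom (U t) := by simp [index]

lemma mem_cell {R : Finset (HPoint d)} {U : Fin k → HPoint d} {T : Finset (Fin k)}
    {x : HPoint d} : x ∈ cell R U T ↔ x ∈ R ∧ index U x = T := by
  simp [cell, Finset.ext_iff, mem_index]

lemma subset_commonDom {U : Fin k → HPoint d} {I : Finset (Fin d)} :
    I ⊆ commonDom U ↔ ∀ t, I ⊆ dom (U t) := by
  constructor
  · intro h t i hi
    have := h hi
    simp only [commonDom, Finset.mem_filter] at this
    exact this.2 t
  · intro h i hi
    simp only [commonDom, Finset.mem_filter]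
    exact ⟨Finset.mem_univ _, fun t => h t hi⟩

/-- The points of `R` in the cell of `T` that the optimal clustering puts outside of `T`. -/
def misplaced (τ : HPoint d → Fin k) (R : Finset (HPoint d)) (U : Fin k → HPoint d)
    (T : Finset (Fin k)) : Finset (HPoint d) :=
  (cell R U T).filter fun x => τ x ∉ T

/-- A misplaced point with label `t ∉ T` has an entry outside the domain of its center and is
counted by `openCount` at `t`, which is small in a pruning phase. There are `k - T.card` such
labels. -/
lemma card_misplaced_le {P : Finset (HPoint d)} {Pstar : Fin k → Finset (HPoint d)}
    {τ : HPoint d → Fin k} (hτ : IsLabel P Pstar τ) {s : State k d} (hR : s.R ⊆ P)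
    {c : ℝ} (hc : ∀ t, (openCount Pstar s t : ℝ) < c * (s.R.card : ℝ))
    (T : Finset (Fin k)) :
    ((misplaced τ s.R s.U T).card : ℝ) ≤ (k - T.card : ℝ) * (c * s.R.card) := by
  have h1 : (misplaced τ s.R s.U T).card =
      ∑ t ∈ Tᶜ, ((misplaced τ s.R s.U T).filter fun x => τ x = t).card :=
    Finset.card_eq_sum_card_fiberwise fun x hx => by
      have := (Finset.mem_filter.1 hx).2
      simpa using this
  have h2 : ∀ t ∈ Tᶜ, ((misplaced τ s.R s.U T).filter fun x => τ x = t).card ≤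
      openCount Pstar s t := by
    intro t ht
    refine Finset.card_le_card fun x hx => ?_
    obtain ⟨hx, hxt⟩ := Finset.mem_filter.1 hx
    obtain ⟨hxR, hxT⟩ := mem_cell.1 (Finset.mem_filter.1 hx).1
    have hnot : ¬ dom x ⊆ dom (s.U t) := by
      rw [← mem_index, hxT]
      simpa using ht
    obtain ⟨i, hi, hi'⟩ := Finset.not_subset.1 hnot
    refine Finset.mem_filter.2 ⟨Finset.mem_inter.2 ⟨hxR, (hτ x t).2 ⟨hR hxR, hxt⟩⟩, i, ?_⟩
    simp [hi, hi']
  have h3 : ((misplaced τ s.R s.U T).card : ℝ) ≤ ∑ t ∈ Tᶜ, c * (s.R.card : ℝ) := by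
    rw [h1]
    push_cast
    refine Finset.sum_le_sum fun t ht => ?_
    exact le_trans (by exact_mod_cast h2 t ht) (hc t).le
  refine h3.trans (le_of_eq ?_)
  rw [Finset.sum_const, nsmul_eq_mul, Finset.card_compl, Fintype.card_fin,
    Nat.cast_sub (by simpa using Finset.card_le_univ T)]

/-- Pigeonhole over the `2 ^ k` index sets; the full index set, which pruning may not choose, has an
empty cell by `hfresh`. -/
lemma card_le_of_cell_card_le {R : Finset (HPoint d)} {U : Fin k → HPoint d}
    (hfresh : ∀ x ∈ R, ¬ dom x ⊆ commonDom U) {m : ℕ}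
    (h : ∀ T : Finset (Fin k), T ≠ Finset.univ → (cell R U T).card ≤ m) :
    R.card ≤ 2 ^ k * m := by
  have := Finset.card_le_mul_card_image_of_maps_to (s := R) (f := index U)
    (t := (Finset.univ : Finset (Finset (Fin k)))) (fun _ _ => Finset.mem_univ _) m
    (fun T _ => ?_)
  · simpa [mul_comm] using this
  · have hcell : R.filter (fun x => index U x = T) = cell R U T := by
      ext x; simp [mem_cell]
    rw [hcell]
    by_cases hT : T = Finset.univ
    · have : cell R U T = ∅ := by
        refine Finset.eq_empty_of_forall_notMem fun x hx => ?_
        obtain ⟨hxR, hxT⟩ := mem_cell.1 hx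
        refine hfresh x hxR (subset_commonDom.2 fun t => ?_)
        rw [← mem_index, hxT, hT]
        exact Finset.mem_univ t
      simp [this]
    · exact h T hT

/-! ### The structural invariant -/

/-- The properties of the state that hold regardless of the outcome of the sampling. -/
structure Valid (Δ : ℕ) (P : Finset (HPoint d)) (s : State k d) : Prop where
  disjoint_clusters : ∀ t t', t ≠ t' → Disjoint (s.clusters t) (s.clusters t')
  disjoint_rest : ∀ t, Disjoint (s.clusters t) s.R
  mem_iff : ∀ x, x ∈ P ↔ (∃ t, x ∈ s.clusters t) ∨ x ∈ s.R
  fresh : ∀ x ∈ s.R, ¬ dom x ⊆ commonDom s.U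
  centers : ∀ t, dom (s.U t) = ∅ ∨ d ≤ (dom (s.U t)).card + Δ

lemma dom_nullPoint : dom (nullPoint : HPoint d) = ∅ := by simp [dom, nullPoint]

lemma valid_initState {Δ : ℕ} (hk : 1 ≤ k) (hΔ : Δ < d) {P : Finset (HPoint d)}
    (hP : ∀ x ∈ P, IsMissing Δ x) : Valid Δ P (initState k P) where
  disjoint_clusters := by simp [initState]
  disjoint_rest := by simp [initState]
  mem_iff := by simp [initState]
  fresh := fun x hx h => by
    have h0 := subset_commonDom.1 h ⟨0, hk⟩
    simp only [initState, dom_nullPoint] at h0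
    exact ((hP x hx).dom_nonempty hΔ).ne_empty (Finset.subset_empty.1 h0)
  centers := fun t => Or.inl (by simp [initState, dom_nullPoint])

lemma Valid.rest_subset {Δ : ℕ} {P : Finset (HPoint d)} {s : State k d} (h : Valid Δ P s) :
    s.R ⊆ P := fun x hx => (h.mem_iff x).2 (Or.inr hx)

lemma mem_assign {A : Fin k → Finset (HPoint d)} {B : Finset (HPoint d)}
    {a : HPoint d → Fin k} {t : Fin k} {x : HPoint d} :
    x ∈ assign A B a t ↔ x ∈ A t ∨ x ∈ B ∧ a x = t := by
  simp [assign]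

lemma Valid.assign {Δ : ℕ} {P : Finset (HPoint d)} {s : State k d} (h : Valid Δ P s)
    {U : Fin k → HPoint d} {B : Finset (HPoint d)} (hB : B ⊆ s.R) (a : HPoint d → Fin k)
    (hfresh : ∀ x ∈ s.R \ B, ¬ dom x ⊆ commonDom U)
    (hcenters : ∀ t, dom (U t) = ∅ ∨ d ≤ (dom (U t)).card + Δ) :
    Valid Δ P { R := s.R \ B, U := U, clusters := assign s.clusters B a } where
  disjoint_clusters := fun t t' htt' => by
    refine Finset.disjoint_left.2 fun x hx hx' => ?_
    rcases mem_assign.1 hx with h1 | ⟨h1, h1'⟩ <;> rcases mem_assign.1 hx' with h2 | ⟨h2, h2'⟩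
    · exact Finset.disjoint_left.1 (h.disjoint_clusters t t' htt') h1 h2
    · exact Finset.disjoint_left.1 (h.disjoint_rest t) h1 (hB h2)
    · exact Finset.disjoint_left.1 (h.disjoint_rest t') h2 (hB h1)
    · exact htt' (h1'.symm.trans h2')
  disjoint_rest := fun t => by
    refine Finset.disjoint_left.2 fun x hx hx' => ?_
    obtain ⟨hxR, hxB⟩ := Finset.mem_sdiff.1 hx'
    rcases mem_assign.1 hx with h1 | ⟨h1, -⟩
    · exact Finset.disjoint_left.1 (h.disjoint_rest t) h1 hxR
    · exact hxB h1
  mem_iff := fun x => by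
    rw [h.mem_iff]
    simp only [mem_assign, Finset.mem_sdiff]
    constructor
    · rintro (⟨t, ht⟩ | hx)
      · exact Or.inl ⟨t, Or.inl ht⟩
      · by_cases hxB : x ∈ B
        · exact Or.inl ⟨a x, Or.inr ⟨hxB, rfl⟩⟩
        · exact Or.inr ⟨hx, hxB⟩
    · rintro (⟨t, ht | ⟨hx, -⟩⟩ | hx)
      · exact Or.inl ⟨t, ht⟩
      · exact Or.inr (hB hx)
      · exact Or.inr hx.1
  fresh := hfresh
  centers := hcenters

lemma FD_subset (R : Finset (HPoint d)) (I : Finset (Fin d)) : FD R I ⊆ R :=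
  Finset.filter_subset _ _

lemma mem_FD {R : Finset (HPoint d)} {I : Finset (Fin d)} {x : HPoint d} :
    x ∈ FD R I ↔ x ∈ R ∧ dom x ⊆ I := Finset.mem_filter

lemma Valid.endOfSampling {Δ : ℕ} {P : Finset (HPoint d)} {s s' : State k d} (h : Valid Δ P s)
    {t : Fin k} {u : HPoint d} (hu : d ≤ (dom u).card + Δ)
    (he : EndOfSampling s (Function.update s.U t u) s') : Valid Δ P s' := by
  obtain ⟨a, -, rfl⟩ := he
  refine h.assign (FD_subset _ _) a (fun x hx hx' => ?_) (fun t' => ?_)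
  · obtain ⟨hxR, hxF⟩ := Finset.mem_sdiff.1 hx
    exact hxF (mem_FD.2 ⟨hxR, hx'⟩)
  · by_cases ht : t' = t
    · subst ht; simpa using Or.inr hu
    · simpa [Function.update_of_ne ht] using h.centers t'

lemma Valid.prune {Δ : ℕ} {P : Finset (HPoint d)} {s : State k d} (h : Valid Δ P s)
    {B : Finset (HPoint d)} (hB : B ⊆ s.R) (a : HPoint d → Fin k) :
    Valid Δ P { R := s.R \ B, U := s.U, clusters := MissingKMeans.assign s.clusters B a } :=
  h.assign hB a (fun x hx => h.fresh x (Finset.mem_sdiff.1 hx).1) h.centers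

/-! ### A phase is always possible -/

lemma exists_isClosest (U : Fin k → HPoint d) {T : Finset (Fin k)} (hT : T.Nonempty)
    (x : HPoint d) : ∃ t, IsClosest U T x t := by
  obtain ⟨t, ht, h⟩ := T.exists_min_image (fun t => distOn Finset.univ x (U t)) hT
  exact ⟨t, ht, h⟩

lemma exists_endOfSampling (hk : 1 ≤ k) (s : State k d) (U' : Fin k → HPoint d) :
    ∃ s', EndOfSampling s U' s' := by
  have hne : (Finset.univ : Finset (Fin k)).Nonempty := ⟨⟨0, hk⟩, Finset.mem_univ _⟩
  choose a ha using exists_isClosest U' hne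
  exact ⟨_, a, fun x _ => ha x, rfl⟩

/-- A finite set has an initial segment of each possible size for every real-valued key. -/
lemma exists_initial_segment {ι : Type*} [DecidableEq ι] (S : Finset ι) (f : ι → ℝ) (m : ℕ)
    (hm : m ≤ S.card) :
    ∃ B ⊆ S, B.card = m ∧ ∀ x ∈ B, ∀ y ∈ S \ B, f x ≤ f y := by
  induction m with
  | zero => exact ⟨∅, by simp⟩
  | succ m ih =>
    obtain ⟨B, hBS, hBm, hB⟩ := ih (by omega)
    have hne : (S \ B).Nonempty := by
      rw [← Finset.card_pos, Finset.card_sdiff_of_subset hBS]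
      omega
    obtain ⟨z, hz, hmin⟩ := (S \ B).exists_min_image f hne
    obtain ⟨hzS, hzB⟩ := Finset.mem_sdiff.1 hz
    refine ⟨insert z B, Finset.insert_subset hzS hBS, by simp [hzB, hBm], ?_⟩
    intro x hx y hy
    have hy' : y ∈ S \ B := by
      simp only [Finset.mem_sdiff, Finset.mem_insert, not_or] at hy ⊢
      exact ⟨hy.1, hy.2.2⟩
    rcases Finset.mem_insert.1 hx with rfl | hx
    · exact hmin y hy'
    · exact hB x hx y hy'

lemma exists_isFirstHalf (U : Fin k → HPoint d) {T : Finset (Fin k)} (hT : T.Nonempty)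
    (S : Finset (HPoint d)) : ∃ B, IsFirstHalf U T S B := by
  choose a ha using exists_isClosest U hT
  obtain ⟨B, hBS, hBm, hB⟩ := exists_initial_segment S
    (fun x => distOn Finset.univ x (U (a x))) ((S.card + 1) / 2) (by omega)
  exact ⟨B, hBS, hBm, fun x hx y hy t' ht' =>
    ⟨a x, (ha x).1, (hB x hx y hy).trans ((ha y).2 t' ht')⟩⟩

/-- A phase rule is constrained only where some phase exists. The obstacle is a largest cell with `T
= ∅`, which would leave no center to assign to. -/
lemma exists_phase {Δ : ℕ} (hk : 1 ≤ k) {P : Finset (HPoint d)}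
    {Pstar : Fin k → Finset (HPoint d)} {τ : HPoint d → Fin k} (hτ : IsLabel P Pstar τ)
    {c : ℝ} (hc : 0 < c) (hc' : 4 * 2 ^ k * c * k ≤ 1) (ps : PointSampler d Δ)
    (vs : ValueSampler d) {s : State k d} (hs : Valid Δ P s) (hR : s.R.Nonempty) :
    ∃ μ, Phase Pstar c ps vs s μ := by
  have hRpos : (0 : ℝ) < s.R.card := by exact_mod_cast hR.card_pos
  by_cases hex : ∀ t, (openCount Pstar s t : ℝ) < c * (s.R.card : ℝ)
  · obtain ⟨T, hT, hmax⟩ := (Finset.univ.erase (Finset.univ : Finset (Fin k))).exists_max_image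
      (fun T => (cell s.R s.U T).card) ⟨∅, by
        simp only [Finset.mem_erase, Finset.mem_univ, and_true]
        exact (Finset.Nonempty.ne_empty ⟨⟨0, hk⟩, Finset.mem_univ _⟩).symm⟩
    have hT' : T ≠ Finset.univ := Finset.ne_of_mem_erase hT
    have hmax' : ∀ T' : Finset (Fin k), T' ≠ Finset.univ →
        (cell s.R s.U T').card ≤ (cell s.R s.U T).card := fun T' h =>
      hmax T' (Finset.mem_erase.2 ⟨h, Finset.mem_univ _⟩)
    -- For `T = ∅` the whole cell is misplaced, so `|R| ≤ 2 ^ k * k * c * |R| ≤ |R| / 4`, which is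
    -- impossible.
    have hTne : T.Nonempty := by
      rw [Finset.nonempty_iff_ne_empty]
      rintro rfl
      have h1 := card_misplaced_le hτ hs.rest_subset hex ∅
      have h2 : misplaced τ s.R s.U ∅ = cell s.R s.U ∅ := by simp [misplaced]
      rw [h2] at h1
      have h3 : (s.R.card : ℝ) ≤ 2 ^ k * (cell s.R s.U ∅).card := by
        exact_mod_cast card_le_of_cell_card_le hs.fresh hmax'
      simp only [Finset.card_empty, Nat.cast_zero, sub_zero] at h1
      have h4 : (2 : ℝ) ^ k * (cell s.R s.U ∅).card ≤ 2 ^ k * (k * (c * s.R.card)) := by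
        gcongr
      nlinarith
    obtain ⟨B, hB⟩ := exists_isFirstHalf s.U hTne (cell s.R s.U T)
    choose a ha using exists_isClosest s.U hTne
    exact ⟨_, Phase.prune T B a hex hT' hmax' hB fun x _ => ha x⟩
  · push Not at hex
    obtain ⟨t₀, ht₀⟩ := hex
    obtain ⟨t, -, hmax⟩ := Finset.univ.exists_max_image (openCount Pstar s)
      ⟨t₀, Finset.mem_univ _⟩
    have ht : c * (s.R.card : ℝ) ≤ openCount Pstar s t :=
      ht₀.trans (by exact_mod_cast hmax t₀ (Finset.mem_univ _))
    by_cases hI : dom (s.U t) = ∅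
    · choose g hg using fun u : {u : HPoint d // IsMissing Δ u} =>
        exists_endOfSampling hk s (Function.update s.U t u.1)
      exact ⟨_, Phase.samplePoint t g (fun t' => hmax t' (Finset.mem_univ _)) ht hI hg⟩
    · have hpos : 0 < openCount Pstar s t := by
        have : (0 : ℝ) < openCount Pstar s t := lt_of_lt_of_le (by positivity) ht
        exact_mod_cast this
      obtain ⟨x, hx⟩ := Finset.card_pos.1 hpos
      obtain ⟨i, hi⟩ := (Finset.mem_filter.1 hx).2
      obtain ⟨j, hj, hjmax⟩ := (Finset.univ \ dom (s.U t)).exists_max_image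
        (fun j => (PD (s.R ∩ Pstar t) {j}).card) ⟨i, (Finset.mem_inter.1 hi).2⟩
      choose g hg using fun x : ℝ => exists_endOfSampling hk s
        (Function.update s.U t (Function.update (s.U t) j (some x)))
      exact ⟨_, Phase.sampleValue t j g (fun t' => hmax t' (Finset.mem_univ _)) ht hI
        (Finset.mem_sdiff.1 hj).2
        (fun i hi => hjmax i (Finset.mem_sdiff.2 ⟨Finset.mem_univ _, hi⟩)) hg⟩

/-! ### Accounting for the cost of a successful run -/

/-- The points of `R` that are fully defined on the center of their optimal cluster. -/
def settled (τ : HPoint d → Fin k) (R : Finset (HPoint d)) (U : Fin k → HPoint d) :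
    Finset (HPoint d) :=
  R.filter fun x => dom x ⊆ dom (U (τ x))

lemma mem_settled {τ : HPoint d → Fin k} {R : Finset (HPoint d)} {U : Fin k → HPoint d}
    {x : HPoint d} : x ∈ settled τ R U ↔ x ∈ R ∧ dom x ⊆ dom (U (τ x)) := Finset.mem_filter

/-- The squared distance of `x` to the center of its optimal cluster. -/
noncomputable def optDist (τ : HPoint d → Fin k) (U : Fin k → HPoint d) (x : HPoint d) : ℝ :=
  sqDist x (U (τ x))

lemma optDist_nonneg (τ : HPoint d → Fin k) (U : Fin k → HPoint d) (x : HPoint d) :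
    0 ≤ optDist τ U x := sqDist_nonneg _ _

/-- The bookkeeping of a run in which all samples were successful. `G` is the set of the points
that were settled when they were assigned, and `lam T` bounds from below the distances of the
settled points in the cell of `T`. A point assigned while not settled is charged to settled points:
`K` times to those assigned later, `κ` times per sampling phase to those seen so far. -/
structure Accounted (Δ : ℕ) (α K κ : ℝ) (Pstar : Fin k → Finset (HPoint d))
    (Cstar : Fin k → Fin d → ℝ) (τ : HPoint d → Fin k) (P : Finset (HPoint d)) (s : State k d)
    (G : Finset (HPoint d)) (lam : Finset (Fin k) → ℝ) : Prop where
  fits : ∀ t, ∀ x ∈ s.clusters t, dom x ⊆ dom (s.U t)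
  subset : G ⊆ P
  disjoint : Disjoint G s.R
  fits_opt : ∀ x ∈ G, dom x ⊆ dom (s.U (τ x))
  near : ∀ t, costOn (dom (s.U t)) ((s.R ∪ G) ∩ Pstar t) (s.U t) ≤
    (1 + α) * costOn (dom (s.U t)) (Pstar t) (full (Cstar t))
  lam_nonneg : ∀ T, 0 ≤ lam T
  lam_le : ∀ x ∈ settled τ s.R s.U, lam (index s.U x) ≤ optDist τ s.U x
  bound : ∑ t, ∑ x ∈ s.clusters t, sqDist x (s.U t) ≤
    (1 + K) * ∑ x ∈ G, optDist τ s.U x +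
    κ * totalRank Δ s.U * (∑ x ∈ G, optDist τ s.U x + ∑ x ∈ settled τ s.R s.U, optDist τ s.U x) +
    κ * ∑ x ∈ settled τ s.R s.U, lam (index s.U x)

lemma sum_assign {A : Fin k → Finset (HPoint d)} {B : Finset (HPoint d)} (a : HPoint d → Fin k)
    (h : ∀ t, Disjoint (A t) B) (f : HPoint d → Fin k → ℝ) :
    ∑ t, ∑ x ∈ assign A B a t, f x t = ∑ t, ∑ x ∈ A t, f x t + ∑ x ∈ B, f x (a x) := by
  have h1 : ∀ t, ∑ x ∈ assign A B a t, f x t =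
      ∑ x ∈ A t, f x t + ∑ x ∈ B with a x = t, f x (a x) := fun t => by
    rw [assign, Finset.sum_union ((h t).mono_right (Finset.filter_subset _ _))]
    congr 1
    exact Finset.sum_congr rfl fun x hx => by rw [(Finset.mem_filter.1 hx).2]
  rw [Finset.sum_congr rfl fun t _ => h1 t, Finset.sum_add_distrib]
  congr 1
  exact Finset.sum_fiberwise B a fun x => f x (a x)

section

variable {Δ : ℕ} {α K κ : ℝ} {Pstar : Fin k → Finset (HPoint d)} {Cstar : Fin k → Fin d → ℝ}
  {τ : HPoint d → Fin k} {P : Finset (HPoint d)} {s : State k d} {G : Finset (HPoint d)}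
  {lam : Finset (Fin k) → ℝ}

lemma optDist_congr {U V : Fin k → HPoint d} (h : ∀ t, Extends (U t) (V t)) {x : HPoint d}
    (hx : dom x ⊆ dom (U (τ x))) : optDist τ V x = optDist τ U x :=
  sqDist_congr_of_dom_subset hx (h _)

/-- The cells change with the centers, so `lam` restarts at zero. The discarded sum of `lam` is at
most the sum of `optDist` over the settled points, which the gain in total rank pays for. The points
assigned now choose among all centers, so each costs at most its `optDist`, and they join `G`. -/
lemma Accounted.endOfSampling (hK : 0 ≤ K) (hκ : 0 ≤ κ) (hs : Valid Δ P s)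
    (h : Accounted Δ α K κ Pstar Cstar τ P s G lam) {t : Fin k} {u : HPoint d}
    (hext : Extends (s.U t) u) (hrank : rank Δ (s.U t) < rank Δ u)
    (hnear : costOn (dom u) ((s.R ∪ G) ∩ Pstar t) u ≤
      (1 + α) * costOn (dom u) (Pstar t) (full (Cstar t)))
    {s' : State k d} (he : EndOfSampling s (Function.update s.U t u) s') :
    ∃ G' lam', Accounted Δ α K κ Pstar Cstar τ P s' G' lam' := by
  have hlt := totalRank_lt_update (U := s.U) hrank
  have hExt := extends_update_center hext
  have hnear' : ∀ t', costOn (dom (Function.update s.U t u t')) ((s.R ∪ G) ∩ Pstar t')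
      (Function.update s.U t u t') ≤ (1 + α) *
        costOn (dom (Function.update s.U t u t')) (Pstar t') (full (Cstar t')) := fun t' => by
    by_cases ht : t' = t
    · subst ht; simpa using hnear
    · simpa [Function.update_of_ne ht] using h.near t'
  obtain ⟨a, ha, rfl⟩ := he
  generalize Function.update s.U t u = V at *
  set F := FD s.R (commonDom V) with hF
  have hFR : F ⊆ s.R := FD_subset _ _
  have hFdom : ∀ x ∈ F, ∀ t, dom x ⊆ dom (V t) := fun x hx =>
    subset_commonDom.1 (mem_FD.1 hx).2
  have hGF : Disjoint G F := h.disjoint.mono_right hFR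
  have hG : ∑ x ∈ G, optDist τ V x = ∑ x ∈ G, optDist τ s.U x :=
    Finset.sum_congr rfl fun x hx => optDist_congr hExt (h.fits_opt x hx)
  -- Old settled points are assigned now or stay settled, at unchanged distance; further points may
  -- become settled.
  have hS : ∑ x ∈ settled τ s.R s.U, optDist τ s.U x ≤
      ∑ x ∈ F, optDist τ V x + ∑ x ∈ settled τ (s.R \ F) V, optDist τ V x := by
    have hdisj : Disjoint F (settled τ (s.R \ F) V) :=
      Finset.disjoint_left.2 fun x hx hx' =>
        (Finset.mem_sdiff.1 (mem_settled.1 hx').1).2 hx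
    rw [← Finset.sum_union hdisj, ← Finset.sum_congr rfl fun x hx =>
      optDist_congr (τ := τ) hExt (mem_settled.1 hx).2]
    refine Finset.sum_le_sum_of_subset_of_nonneg (fun x hx => ?_) fun _ _ _ =>
      optDist_nonneg _ _ _
    obtain ⟨hxR, hxd⟩ := mem_settled.1 hx
    by_cases hxF : x ∈ F
    · exact Finset.mem_union_left _ hxF
    · exact Finset.mem_union_right _ (mem_settled.2
        ⟨Finset.mem_sdiff.2 ⟨hxR, hxF⟩, hxd.trans (hExt _).dom_subset⟩)
  refine ⟨G ∪ F, fun _ => 0, ?_⟩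
  constructor
  · intro t' x hx
    rcases mem_assign.1 hx with hx | ⟨hx, -⟩
    · exact (h.fits t' x hx).trans (hExt t').dom_subset
    · exact hFdom x hx t'
  · exact Finset.union_subset h.subset (hFR.trans hs.rest_subset)
  · refine Finset.disjoint_union_left.2 ⟨h.disjoint.mono_right Finset.sdiff_subset, ?_⟩
    exact Finset.disjoint_sdiff
  · intro x hx
    rcases Finset.mem_union.1 hx with hx | hx
    · exact (h.fits_opt x hx).trans (hExt _).dom_subset
    · exact hFdom x hx _
  · intro t'
    refine le_trans (costOn_mono_set _ (fun x hx => ?_) _) (hnear' t')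
    simp only [Finset.mem_inter, Finset.mem_union, Finset.mem_sdiff] at hx ⊢
    refine ⟨?_, hx.2⟩
    rcases hx.1 with hx | hx | hx
    · exact Or.inl hx.1
    · exact Or.inr hx
    · exact Or.inl (hFR hx)
  · exact fun _ => le_rfl
  · exact fun x _ => optDist_nonneg _ _ _
  · have hclust : ∑ t, ∑ x ∈ s.clusters t, sqDist x (V t) =
        ∑ t, ∑ x ∈ s.clusters t, sqDist x (s.U t) :=
      Finset.sum_congr rfl fun t' _ => Finset.sum_congr rfl fun x hx =>
        sqDist_congr_of_dom_subset (h.fits t' x hx) (hExt t')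
    have hFle : ∑ x ∈ F, sqDist x (V (a x)) ≤ ∑ x ∈ F, optDist τ V x :=
      Finset.sum_le_sum fun x hx => sqDist_le_sqDist ((ha x hx).2 (τ x) (Finset.mem_univ _))
    have hlam : ∑ x ∈ settled τ s.R s.U, lam (index s.U x) ≤
        ∑ x ∈ settled τ s.R s.U, optDist τ s.U x := Finset.sum_le_sum h.lam_le
    have hbound := h.bound
    simp only [Finset.sum_const_zero, mul_zero, add_zero]
    rw [sum_assign a (fun t' => (hs.disjoint_rest t').mono_right hFR) (fun x t => sqDist x (V t)),
      hclust, Finset.sum_union hGF, hG]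
    have hF0 : 0 ≤ ∑ x ∈ F, optDist τ V x := Finset.sum_nonneg fun _ _ => optDist_nonneg _ _ _
    have hG0 : 0 ≤ ∑ x ∈ G, optDist τ s.U x := Finset.sum_nonneg fun _ _ => optDist_nonneg _ _ _
    have hS0 : 0 ≤ ∑ x ∈ settled τ s.R s.U, optDist τ s.U x :=
      Finset.sum_nonneg fun _ _ => optDist_nonneg _ _ _
    have hM : (totalRank Δ s.U : ℝ) + 1 ≤ totalRank Δ V := by exact_mod_cast hlt
    have hM0 : (0 : ℝ) ≤ totalRank Δ s.U := Nat.cast_nonneg _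
    generalize ∑ x ∈ F, optDist τ V x = f at *
    generalize ∑ x ∈ G, optDist τ s.U x = g at *
    generalize ∑ x ∈ settled τ s.R s.U, optDist τ s.U x = r at *
    generalize ∑ x ∈ settled τ (s.R \ F) V, optDist τ V x = r' at *
    have h1 : κ * totalRank Δ s.U * (g + r) + κ * r ≤ κ * totalRank Δ V * (g + f + r') := by
      calc κ * totalRank Δ s.U * (g + r) + κ * r
          ≤ κ * (totalRank Δ s.U + 1) * (g + r) := by nlinarith [mul_nonneg hκ hG0]
        _ ≤ κ * totalRank Δ V * (g + f + r') := by
            refine mul_le_mul (by gcongr) (by linarith) (by linarith) ?_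
            exact mul_nonneg hκ (Nat.cast_nonneg _)
    have h2 : κ * ∑ x ∈ settled τ s.R s.U, lam (index s.U x) ≤ κ * r := by gcongr
    have h3 : 0 ≤ K * f := mul_nonneg hK hF0
    linarith

/-- With old and new thresholds `l₀ ≤ l`, the misplaced part `b` of `B` costs at most `|b| * l₀ +
|b| * (l - l₀)`. The first term is charged with factor `K - κ` to the settled points `g` leaving
with `B`, all at distance at least `l₀`; the second is covered by the growth of the `lam` sum over
the settled points `w` left behind. Removing `g` also takes `κ * |g| * l₀` out of that sum, which
explains the remaining `κ` in `K`. -/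
lemma Accounted.prune (hK : κ ≤ K) (hκ : 0 ≤ κ) (hs : Valid Δ P s)
    (h : Accounted Δ α K κ Pstar Cstar τ P s G lam) {T : Finset (Fin k)} {B : Finset (HPoint d)}
    {a : HPoint d → Fin k} (hB : IsFirstHalf s.U T (cell s.R s.U T) B)
    (ha : ∀ x ∈ B, IsClosest s.U T x (a x))
    (hcard : ((B.filter fun x => τ x ∉ T).card : ℝ) ≤
      (K - κ) * (B.filter fun x => τ x ∈ T).card)
    (hcard' : ((B.filter fun x => τ x ∉ T).card : ℝ) ≤
      κ * ((cell s.R s.U T \ B).filter fun x => τ x ∈ T).card) :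
    ∃ G' lam', Accounted Δ α K κ Pstar Cstar τ P
      { R := s.R \ B, U := s.U, clusters := assign s.clusters B a } G' lam' := by
  have hBcell := hB.1
  have hBR : B ⊆ s.R := fun x hx => (mem_cell.1 (hBcell hx)).1
  have hidx : ∀ x ∈ B, index s.U x = T := fun x hx => (mem_cell.1 (hBcell hx)).2
  set g := B.filter fun x => τ x ∈ T with hg
  set b := B.filter fun x => τ x ∉ T with hb
  set w := (cell s.R s.U T \ B).filter fun x => τ x ∈ T with hw
  have hgB : g ⊆ B := Finset.filter_subset _ _
  have hgdom : ∀ x ∈ g, dom x ⊆ dom (s.U (τ x)) := fun x hx => by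
    rw [← mem_index, hidx x (hgB hx)]
    exact (Finset.mem_filter.1 hx).2
  have hgset : ∀ x ∈ g, x ∈ settled τ s.R s.U := fun x hx =>
    mem_settled.2 ⟨hBR (hgB hx), hgdom x hx⟩
  have hwset : ∀ x ∈ w, x ∈ settled τ s.R s.U ∧ index s.U x = T := fun x hx => by
    obtain ⟨hx, hxT⟩ := Finset.mem_filter.1 hx
    obtain ⟨hxR, hxi⟩ := mem_cell.1 (Finset.mem_sdiff.1 hx).1
    refine ⟨mem_settled.2 ⟨hxR, ?_⟩, hxi⟩
    rw [← mem_index, hxi]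
    exact hxT
  -- The new threshold is the larger of the old one and the greatest squared distance in `b`. It
  -- still lies below the points of `w`, because `B` precedes them in the order by distance.
  obtain ⟨l, hl, hlb, hlw⟩ : ∃ l, lam T ≤ l ∧ (∀ x ∈ b, sqDist x (s.U (a x)) ≤ l) ∧
      ∀ y ∈ w, l ≤ optDist τ s.U y := by
    have hlamw : ∀ y ∈ w, lam T ≤ optDist τ s.U y := fun y hy => by
      obtain ⟨hy1, hy2⟩ := hwset y hy
      rw [← hy2]
      exact h.lam_le y hy1
    rcases b.eq_empty_or_nonempty with hb0 | hb0
    · exact ⟨lam T, le_rfl, by simp [hb0], hlamw⟩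
    · obtain ⟨z, hz, hmax⟩ := b.exists_max_image (fun x => sqDist x (s.U (a x))) hb0
      refine ⟨max (lam T) (sqDist z (s.U (a z))), le_max_left _ _,
        fun x hx => le_max_of_le_right (hmax x hx), fun y hy => max_le (hlamw y hy) ?_⟩
      obtain ⟨hy1, hy2⟩ := Finset.mem_filter.1 hy
      have hzB := (Finset.mem_filter.1 hz).1
      obtain ⟨t, ht, hle⟩ := hB.2.2 z hzB y hy1 (τ y) hy2
      exact sqDist_le_sqDist (((ha z hzB).2 t ht).trans hle)
  have hsplit : ∀ f : HPoint d → ℝ, ∑ x ∈ settled τ s.R s.U, f x =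
      ∑ x ∈ g, f x + ∑ x ∈ settled τ (s.R \ B) s.U, f x := fun f => by
    rw [← Finset.sum_union]
    · refine Finset.sum_congr (Finset.ext fun x => ?_) fun _ _ => rfl
      rw [Finset.mem_union, mem_settled, mem_settled, Finset.mem_sdiff]
      constructor
      · rintro ⟨hx, hxd⟩
        by_cases hxB : x ∈ B
        · refine Or.inl (Finset.mem_filter.2 ⟨hxB, ?_⟩)
          rw [← hidx x hxB, mem_index]
          exact hxd
        · exact Or.inr ⟨⟨hx, hxB⟩, hxd⟩
      · rintro (hx | hx)
        · exact ⟨hBR (hgB hx), hgdom x hx⟩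
        · exact ⟨hx.1.1, hx.2⟩
    · exact Finset.disjoint_left.2 fun x hx hx' =>
        (Finset.mem_sdiff.1 (mem_settled.1 hx').1).2 (hgB hx)
  have hwfilter : (settled τ (s.R \ B) s.U).filter (fun x => index s.U x = T) = w := by
    ext x
    simp only [hw, Finset.mem_filter, mem_settled, Finset.mem_sdiff, mem_cell]
    constructor
    · rintro ⟨⟨⟨h1, h2⟩, h3⟩, h4⟩
      exact ⟨⟨⟨h1, h4⟩, h2⟩, by rwa [← h4, mem_index]⟩
    · rintro ⟨⟨⟨h1, h4⟩, h2⟩, h5⟩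
      exact ⟨⟨⟨h1, h2⟩, by rwa [← h4, mem_index] at h5⟩, h4⟩
  have hlamsum : ∑ x ∈ settled τ (s.R \ B) s.U, Function.update lam T l (index s.U x) =
      ∑ x ∈ settled τ (s.R \ B) s.U, lam (index s.U x) + w.card * (l - lam T) := by
    rw [← hwfilter, ← nsmul_eq_mul, ← Finset.sum_const, Finset.sum_filter,
      ← Finset.sum_add_distrib]
    refine Finset.sum_congr rfl fun x _ => ?_
    by_cases hx : index s.U x = T
    · simp [hx]
    · simp [hx]
  have hlamg : ∑ x ∈ g, lam (index s.U x) = g.card * lam T := by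
    rw [← nsmul_eq_mul, ← Finset.sum_const]
    exact Finset.sum_congr rfl fun x hx => by rw [hidx x (hgB hx)]
  have hgle : g.card * lam T ≤ ∑ x ∈ g, optDist τ s.U x := by
    rw [← hlamg]
    exact Finset.sum_le_sum fun x hx => h.lam_le x (hgset x hx)
  have hGg : Disjoint G g := h.disjoint.mono_right (hgB.trans hBR)
  refine ⟨G ∪ g, Function.update lam T l, ?_⟩
  constructor
  · intro t x hx
    rcases mem_assign.1 hx with hx | ⟨hxB, hxt⟩
    · exact h.fits t x hx
    · change dom x ⊆ dom (s.U t)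
      rw [← mem_index, hidx x hxB, ← hxt]
      exact (ha x hxB).1
  · exact Finset.union_subset h.subset ((hgB.trans hBR).trans hs.rest_subset)
  · refine Finset.disjoint_union_left.2 ⟨h.disjoint.mono_right Finset.sdiff_subset, ?_⟩
    exact Finset.disjoint_sdiff.mono_left hgB
  · intro x hx
    rcases Finset.mem_union.1 hx with hx | hx
    · exact h.fits_opt x hx
    · exact hgdom x hx
  · intro t
    refine le_trans (costOn_mono_set _ (fun x hx => ?_) _) (h.near t)
    simp only [Finset.mem_inter, Finset.mem_union, Finset.mem_sdiff] at hx ⊢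
    refine ⟨?_, hx.2⟩
    rcases hx.1 with hx | hx | hx
    · exact Or.inl hx.1
    · exact Or.inr hx
    · exact Or.inl (hBR (hgB hx))
  · intro T'
    by_cases hT : T' = T
    · subst hT
      simpa using (h.lam_nonneg T').trans hl
    · simpa [Function.update_of_ne hT] using h.lam_nonneg T'
  · intro x hx
    obtain ⟨hx1, hx2⟩ := mem_settled.1 hx
    change Function.update lam T l (index s.U x) ≤ optDist τ s.U x
    by_cases hT : index s.U x = T
    · rw [hT, Function.update_self]
      refine hlw x ?_
      rw [← hwfilter]
      exact Finset.mem_filter.2 ⟨hx, hT⟩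
    · rw [Function.update_of_ne hT]
      exact h.lam_le x (mem_settled.2 ⟨(Finset.mem_sdiff.1 hx1).1, hx2⟩)
  · change ∑ t, ∑ x ∈ assign s.clusters B a t, sqDist x (s.U t) ≤
      (1 + K) * ∑ x ∈ G ∪ g, optDist τ s.U x +
      κ * totalRank Δ s.U * (∑ x ∈ G ∪ g, optDist τ s.U x +
        ∑ x ∈ settled τ (s.R \ B) s.U, optDist τ s.U x) +
      κ * ∑ x ∈ settled τ (s.R \ B) s.U, Function.update lam T l (index s.U x)
    have hbound := h.bound
    rw [hsplit, hsplit, hlamg] at hbound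
    rw [sum_assign a (fun t' => (hs.disjoint_rest t').mono_right hBR)
      (fun x t => sqDist x (s.U t)), Finset.sum_union hGg, hlamsum]
    have hBsum : ∑ x ∈ B, sqDist x (s.U (a x)) ≤ ∑ x ∈ g, optDist τ s.U x + b.card * l := by
      rw [← Finset.sum_filter_add_sum_filter_not B (fun x => τ x ∈ T)]
      refine add_le_add (Finset.sum_le_sum fun x hx => ?_) ?_
      · obtain ⟨hxB, hxT⟩ := Finset.mem_filter.1 hx
        exact sqDist_le_sqDist ((ha x hxB).2 _ hxT)
      · rw [← nsmul_eq_mul]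
        exact Finset.sum_le_card_nsmul _ _ _ hlb
    have hl0 := h.lam_nonneg T
    generalize lam T = l₀ at *
    generalize ∑ x ∈ g, optDist τ s.U x = sg at *
    have h1 : (b.card : ℝ) * l ≤ (K - κ) * sg + κ * w.card * (l - l₀) := by
      calc (b.card : ℝ) * l = b.card * l₀ + b.card * (l - l₀) := by ring
        _ ≤ (K - κ) * g.card * l₀ + κ * w.card * (l - l₀) := by
            have : 0 ≤ l - l₀ := by linarith
            gcongr
        _ ≤ _ := by
            have : (K - κ) * (g.card * l₀) ≤ (K - κ) * sg := by
              have : 0 ≤ K - κ := by linarith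
              gcongr
            linarith
    have h2 : κ * (g.card * l₀) ≤ κ * sg := by gcongr
    linarith

/-! ### The number of misplaced points in a pruning phase -/

/-- Less than a quarter of the cell is misplaced, so the good part `gB` of the first half has at
least `n / 4` points. This gives the factor `4 * e`, written as the difference of the later `K` and
`κ`. -/
lemma card_bounds_of_misplaced {e : ℝ} {n nB gB w m : ℕ} (he : 0 ≤ e) (he' : 4 * e < 1)
    (hm : (m : ℝ) ≤ e * n) (hn : 0 < n) (hBm : nB ≤ m) (hB : nB + gB = (n + 1) / 2)
    (hw : n ≤ (n + 1) / 2 + w + (m - nB)) :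
    (nB : ℝ) ≤ (9 * e - 5 * e) * gB ∧ (nB : ℝ) ≤ 5 * e * w := by
  have h4 : 4 * m < n := by
    have hn' : (0 : ℝ) < n := by exact_mod_cast hn
    have : (4 * m : ℝ) < n := by nlinarith
    exact_mod_cast this
  have hg : n ≤ 4 * gB := by omega
  have hnB : (nB : ℝ) ≤ e * n := le_trans (by exact_mod_cast hBm) hm
  constructor
  · have : (n : ℝ) ≤ 4 * gB := by exact_mod_cast hg
    nlinarith
  · rcases Nat.eq_zero_or_pos nB with h0 | hpos
    · rw [h0]
      push_cast
      positivity
    -- This needs a misplaced point: `n = 1` allows `w = 0`, whereas `nB ≥ 1` and `4 * m < n` force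
    -- `n ≥ 5`.
    · have hw5 : n ≤ 5 * w := by omega
      have : (n : ℝ) ≤ 5 * w := by exact_mod_cast hw5
      nlinarith

/-- Points of `B` have a closest center in `T`, so `T` is nonempty and at most `k - 1` labels are
misplaced. Each accounts for fewer than `c * |R|` points, and `|R|` is at most `2 ^ k` times the
size of the cell. -/
lemma prune_card_bounds (hτ : IsLabel P Pstar τ) (hs : Valid Δ P s) (hR : s.R.Nonempty)
    {c : ℝ} (hc0 : 0 < c) (hk : 1 ≤ k) (hc' : 4 * 2 ^ k * c * k ≤ 1)
    {T : Finset (Fin k)} {B : Finset (HPoint d)} {a : HPoint d → Fin k}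
    (hc : ∀ t, (openCount Pstar s t : ℝ) < c * (s.R.card : ℝ))
    (hmax : ∀ T' : Finset (Fin k), T' ≠ Finset.univ →
      (cell s.R s.U T').card ≤ (cell s.R s.U T).card)
    (hB : IsFirstHalf s.U T (cell s.R s.U T) B) (ha : ∀ x ∈ B, IsClosest s.U T x (a x)) :
    0 < B.card ∧
    ((B.filter fun x => τ x ∉ T).card : ℝ) ≤
      (9 * (2 ^ k * c * (k - 1)) - 5 * (2 ^ k * c * (k - 1))) *
        (B.filter fun x => τ x ∈ T).card ∧
    ((B.filter fun x => τ x ∉ T).card : ℝ) ≤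
      5 * (2 ^ k * c * (k - 1)) * ((cell s.R s.U T \ B).filter fun x => τ x ∈ T).card := by
  have hRcard := card_le_of_cell_card_le hs.fresh hmax
  have hn : 0 < (cell s.R s.U T).card := by
    rcases Nat.eq_zero_or_pos (cell s.R s.U T).card with h0 | h0
    · rw [h0, mul_zero] at hRcard
      have := hR.card_pos
      omega
    · exact h0
  have hBpos : 0 < B.card := by rw [hB.2.1]; omega
  have hTpos : 1 ≤ T.card := by
    obtain ⟨x, hx⟩ := Finset.card_pos.1 hBpos
    exact Finset.card_pos.2 ⟨_, (ha x hx).1⟩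
  have hk1 : (1 : ℝ) ≤ k := by exact_mod_cast hk
  have hpow : (0 : ℝ) < 2 ^ k := by positivity
  have hmis : ((misplaced τ s.R s.U T).card : ℝ) ≤
      2 ^ k * c * (k - 1) * (cell s.R s.U T).card := by
    have h1 : (1 : ℝ) ≤ T.card := by exact_mod_cast hTpos
    have h2 : (s.R.card : ℝ) ≤ 2 ^ k * (cell s.R s.U T).card := by exact_mod_cast hRcard
    calc ((misplaced τ s.R s.U T).card : ℝ)
        ≤ (k - T.card : ℝ) * (c * s.R.card) := card_misplaced_le hτ hs.rest_subset hc T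
      _ ≤ (k - 1 : ℝ) * (c * (2 ^ k * (cell s.R s.U T).card)) := by
          have : (0 : ℝ) ≤ k - 1 := by linarith
          gcongr
      _ = _ := by ring
  have hBsplit := Finset.card_filter_add_card_filter_not (s := B) (fun x => τ x ∈ T)
  have hwsplit := Finset.card_filter_add_card_filter_not (s := cell s.R s.U T \ B)
    (fun x => τ x ∈ T)
  have hmsplit : (misplaced τ s.R s.U T).card = (B.filter fun x => τ x ∉ T).card +
      ((cell s.R s.U T \ B).filter fun x => τ x ∉ T).card := by
    rw [← Finset.card_union_of_disjoint
      (Finset.disjoint_filter_filter Finset.disjoint_sdiff), ← Finset.filter_union,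
      Finset.union_sdiff_of_subset hB.1, misplaced]
  rw [Finset.card_sdiff_of_subset hB.1] at hwsplit
  have hBc := hB.2.1
  refine ⟨hBpos, card_bounds_of_misplaced (m := (misplaced τ s.R s.U T).card)
    (n := (cell s.R s.U T).card) ?_ ?_ hmis hn ?_ ?_ ?_⟩
  · have : (0 : ℝ) ≤ k - 1 := by linarith
    positivity
  · have : 0 < 2 ^ k * c := by positivity
    nlinarith
  · omega
  · omega
  · omega

end

/-! ### Successful samples -/

section

variable {Δ : ℕ} {α K κ : ℝ} {Pstar : Fin k → Finset (HPoint d)} {Cstar : Fin k → Fin d → ℝ}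
  {τ : HPoint d → Fin k} {P : Finset (HPoint d)} {s : State k d} {G : Finset (HPoint d)}
  {lam : Finset (Fin k) → ℝ}

lemma costOn_le_of_centroid (hα : 0 < α) {I : Finset (Fin d)} {R : Finset (HPoint d)} {t : Fin k}
    {u : HPoint d}
    (hu : costOn I (R ∩ Pstar t) u ≤ (1 + α) * costOn I (R ∩ Pstar t) (centroid (R ∩ Pstar t))) :
    costOn I (R ∩ Pstar t) u ≤ (1 + α) * costOn I (Pstar t) (full (Cstar t)) := by
  refine hu.trans ?_
  gcongr
  exact (costOn_centroid_le _ _ _).trans (costOn_mono_set _ Finset.inter_subset_right _)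

/-- No point of `G` has label `t`: its nonempty domain would lie in the empty domain of the null
center. -/
lemma Accounted.near_point (hΔ : Δ < d) (hP : ∀ x ∈ P, IsMissing Δ x)
    (hτ : IsLabel P Pstar τ) (hα : 0 < α)
    (h : Accounted Δ α K κ Pstar Cstar τ P s G lam) {t : Fin k} (hI : dom (s.U t) = ∅)
    {u : HPoint d}
    (hu : costOn (dom u) (s.R ∩ Pstar t) u ≤
      (1 + α) * costOn (dom u) (s.R ∩ Pstar t) (centroid (s.R ∩ Pstar t))) :
    costOn (dom u) ((s.R ∪ G) ∩ Pstar t) u ≤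
      (1 + α) * costOn (dom u) (Pstar t) (full (Cstar t)) := by
  refine le_trans (costOn_mono_set _ (fun x hx => ?_) _) (costOn_le_of_centroid hα hu)
  obtain ⟨hx, hxt⟩ := Finset.mem_inter.1 hx
  rcases Finset.mem_union.1 hx with hx | hx
  · exact Finset.mem_inter.2 ⟨hx, hxt⟩
  · have h1 := h.fits_opt x hx
    obtain ⟨hxP, rfl⟩ := (hτ x t).1 hxt
    rw [hI] at h1
    exact absurd (Finset.subset_empty.1 h1) ((hP x hxP).dom_nonempty hΔ).ne_empty

/-- The old coordinates are covered by `h.near`. On `j`, points of `G` with label `t` have no entry,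
since they already fit the center, so the guarantee of the sample for unassigned points suffices. -/
lemma Accounted.near_value (hτ : IsLabel P Pstar τ) (hα : 0 < α)
    (h : Accounted Δ α K κ Pstar Cstar τ P s G lam) {t : Fin k} {j : Fin d}
    (hj : j ∉ dom (s.U t)) {x : ℝ}
    (hx : costOn {j} (s.R ∩ Pstar t) (full fun _ => x) ≤
      (1 + α) * costOn {j} (s.R ∩ Pstar t) (centroid (s.R ∩ Pstar t))) :
    costOn (dom (Function.update (s.U t) j (some x))) ((s.R ∪ G) ∩ Pstar t)
        (Function.update (s.U t) j (some x)) ≤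
      (1 + α) * costOn (dom (Function.update (s.U t) j (some x))) (Pstar t)
        (full (Cstar t)) := by
  rw [dom_update, costOn_eq_sum, costOn_eq_sum _ (Pstar t), Finset.sum_insert hj,
    Finset.sum_insert hj, ← costOn_eq_sum, ← costOn_eq_sum, mul_add,
    costOn_congr (extends_update hj x)]
  refine add_le_add (le_trans (le_of_eq ?_) (costOn_le_of_centroid hα hx)) (h.near t)
  rw [costOn_singleton_eq _ j (a := x) (by simp), costOn_singleton_eq _ j (a := x) rfl]
  refine Finset.sum_congr (Finset.ext fun y => ?_) fun _ _ => rfl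
  simp only [mem_PD_singleton, Finset.mem_inter, Finset.mem_union]
  constructor
  · rintro ⟨⟨hy | hy, hyt⟩, hyj⟩
    · exact ⟨⟨hy, hyt⟩, hyj⟩
    · have h1 := h.fits_opt y hy
      rw [((hτ y t).1 hyt).2] at h1
      exact absurd (h1 hyj) hj
  · rintro ⟨⟨hy, hyt⟩, hyj⟩
    exact ⟨⟨Or.inl hy, hyt⟩, hyj⟩

lemma accounted_initState :
    Accounted Δ α K κ Pstar Cstar τ P (initState k P) ∅ (fun _ => 0) where
  fits := by simp [initState]
  subset := by simp
  disjoint := by simp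
  fits_opt := by simp
  near := fun t => by simp [initState, dom_nullPoint, costOn, distOn_sq]
  lam_nonneg := fun _ => le_rfl
  lam_le := fun x _ => optDist_nonneg _ _ _
  bound := by
    have : totalRank Δ (initState k P).U = 0 := by
      simp [totalRank, rank, initState, dom_nullPoint]
    rw [this]
    simp [initState]

lemma Accounted.sum_optDist_le (hα : 0 < α) (hτ : IsLabel P Pstar τ)
    (h : Accounted Δ α K κ Pstar Cstar τ P s G lam) :
    ∑ x ∈ G, optDist τ s.U x ≤ (1 + α) * clusteringCost Pstar Cstar := by
  rw [clusteringCost, Finset.mul_sum, ← Finset.sum_fiberwise G τ]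
  refine Finset.sum_le_sum fun t _ => ?_
  calc ∑ x ∈ G with τ x = t, optDist τ s.U x
      = costOn (dom (s.U t)) (G.filter fun x => τ x = t) (s.U t) := by
        refine Finset.sum_congr rfl fun x hx => ?_
        rw [optDist, (Finset.mem_filter.1 hx).2, sqDist_eq_distOn_dom]
    _ ≤ costOn (dom (s.U t)) ((s.R ∪ G) ∩ Pstar t) (s.U t) := by
        refine costOn_mono_set _ (fun x hx => ?_) _
        obtain ⟨hxG, hxt⟩ := Finset.mem_filter.1 hx
        exact Finset.mem_inter.2
          ⟨Finset.mem_union_right _ hxG, (hτ x t).2 ⟨h.subset hxG, hxt⟩⟩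
    _ ≤ _ := h.near t
    _ ≤ (1 + α) * cost (Pstar t) (full (Cstar t)) := by
        gcongr
        exact costOn_mono_coords (Finset.subset_univ _) _ _

/-- With no points left, the sums over settled points vanish and the total rank is at most `k * (Δ +
1)`. Completing the centers is harmless because assigned points fit them. -/
lemma Accounted.isApproxKMeans (hk : 1 ≤ k) (hα : 0 < α) {c : ℝ} (hc : 0 < c)
    (hopt : IsOptimalKMeans P Pstar Cstar) (hτ : IsLabel P Pstar τ) (hs : Valid Δ P s)
    (hR : s.R = ∅)
    (h : Accounted Δ α (9 * (2 ^ k * c * (k - 1))) (5 * (2 ^ k * c * (k - 1)))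
      Pstar Cstar τ P s G lam) {C : Fin k → Fin d → ℝ} (hC : Completes s.U C) :
    IsApproxKMeans ((1 + 8 * 2 ^ k * c * k ^ 2 * (Δ + 1) ^ 2) * (1 + α)) P s.clusters C := by
  refine ⟨⟨hs.disjoint_clusters, ?_⟩, fun A' C' hA' => ?_⟩
  · ext x
    rw [hs.mem_iff, hR]
    simp
  have hcost : clusteringCost s.clusters C = ∑ t, ∑ x ∈ s.clusters t, sqDist x (s.U t) := by
    refine Finset.sum_congr rfl fun t _ => ?_
    rw [cost_eq_sum_sqDist]
    refine Finset.sum_congr rfl fun x hx =>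
      sqDist_congr_of_dom_subset (h.fits t x hx) fun i hi => ?_
    obtain ⟨b, hb⟩ := Option.ne_none_iff_exists'.1 (mem_dom.1 hi)
    rw [hb, full, hC t i b hb]
  have hbound := h.bound
  have hempty : settled τ s.R s.U = ∅ := by simp [settled, hR]
  rw [hempty, ← hcost] at hbound
  simp only [Finset.sum_empty, mul_zero, add_zero] at hbound
  have hX := h.sum_optDist_le hα hτ
  have hX0 : 0 ≤ ∑ x ∈ G, optDist τ s.U x := Finset.sum_nonneg fun _ _ => optDist_nonneg _ _ _
  have hO := hopt.2 A' C' hA'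
  rw [one_mul] at hO
  have hM : (totalRank Δ s.U : ℝ) ≤ k * (Δ + 1) := by exact_mod_cast totalRank_le Δ s.U
  generalize ∑ x ∈ G, optDist τ s.U x = X at *
  have hk1 : (1 : ℝ) ≤ k := by exact_mod_cast hk
  have hD : (0 : ℝ) ≤ Δ := Nat.cast_nonneg _
  have hfac : (k - 1 : ℝ) * (9 + 5 * (k * (Δ + 1))) ≤ 8 * k ^ 2 * (Δ + 1) ^ 2 := by
    have h1 : (k - 1 : ℝ) * 9 ≤ 3 * k ^ 2 + 5 * k := by nlinarith [sq_nonneg ((k : ℝ) - 1)]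
    have h2 : (0 : ℝ) ≤ Δ * k ^ 2 := by positivity
    have h3 : (0 : ℝ) ≤ Δ ^ 2 * k ^ 2 := by positivity
    have h4 : (0 : ℝ) ≤ Δ * k := by positivity
    nlinarith
  have hpow : (0 : ℝ) ≤ 2 ^ k * c := by positivity
  have hκ : (0 : ℝ) ≤ 5 * (2 ^ k * c * (k - 1)) := by
    have : (0 : ℝ) ≤ k - 1 := by linarith
    positivity
  calc clusteringCost s.clusters C
      ≤ (1 + 9 * (2 ^ k * c * (k - 1))) * X +
        5 * (2 ^ k * c * (k - 1)) * (k * (Δ + 1)) * X := hbound.trans (by gcongr)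
    _ = (1 + 2 ^ k * c * ((k - 1) * (9 + 5 * (k * (Δ + 1))))) * X := by ring
    _ ≤ (1 + 2 ^ k * c * (8 * k ^ 2 * (Δ + 1) ^ 2)) * X := by gcongr
    _ ≤ (1 + 2 ^ k * c * (8 * k ^ 2 * (Δ + 1) ^ 2)) * ((1 + α) * clusteringCost A' C') := by
        gcongr
        exact hX.trans (by gcongr)
    _ = _ := by ring

end

/-! ### Success probabilities -/

lemma toOuterMeasure_le_one {β : Type*} (p : PMF β) (S : Set β) : p.toOuterMeasure S ≤ 1 := by
  calc p.toOuterMeasure S ≤ p.toOuterMeasure Set.univ := p.toOuterMeasure.mono (Set.subset_univ S)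
    _ = 1 := (p.toOuterMeasure_apply_eq_one_iff _).2 (Set.subset_univ _)

lemma toOuterMeasure_mul_le_bind {β γ : Type*} (p : PMF β) (f : β → PMF γ) {S : Set β}
    {E : Set γ} {r : ℝ≥0∞} (h : ∀ x ∈ S, r ≤ (f x).toOuterMeasure E) :
    p.toOuterMeasure S * r ≤ (p.bind f).toOuterMeasure E := by
  rw [PMF.toOuterMeasure_bind_apply, PMF.toOuterMeasure_apply, ← ENNReal.tsum_mul_right]
  refine ENNReal.tsum_le_tsum fun x => ?_
  by_cases hx : x ∈ S
  · rw [Set.indicator_of_mem hx]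
    gcongr
    exact h x hx
  · simp [Set.indicator_of_notMem hx]

lemma isMissing_full (Δ : ℕ) (y : Fin d → ℝ) : IsMissing Δ (full y) := by
  simp [IsMissing, full]

lemma pointSuccess_le {Δ : ℕ} {c : ℝ} (α : ℝ) (ps : PointSampler d Δ) {R Q : Finset (HPoint d)}
    (hR : R.Nonempty) (hRm : ∀ x ∈ R, IsMissing Δ x) (hQ : Q ⊆ R)
    (hc : c * (R.card : ℝ) ≤ (Q.card : ℝ)) :
    pointSuccess c α ps ≤ (ps R).toOuterMeasure
      {u | costOn (dom u.1) Q u.1 ≤ (1 + α) * costOn (dom u.1) Q (centroid Q)} :=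
  iInf_le_of_le R <| iInf_le_of_le Q <| iInf_le_of_le hR <| iInf_le_of_le hRm <|
    iInf_le_of_le hQ <| iInf_le_of_le hc le_rfl

lemma valueSuccess_le {c : ℝ} (α : ℝ) (vs : ValueSampler d) {R Q : Finset (HPoint d)}
    (i : Fin d) (hR : R.Nonempty) (hQ : Q ⊆ R)
    (hc : c * (R.card : ℝ) ≤ ((PD Q {i}).card : ℝ)) :
    valueSuccess c α vs ≤ (vs R i).toOuterMeasure
      {x | costOn {i} Q (full fun _ => x) ≤ (1 + α) * costOn {i} Q (centroid Q)} :=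
  iInf_le_of_le R <| iInf_le_of_le Q <| iInf_le_of_le i <| iInf_le_of_le hR <|
    iInf_le_of_le hQ <| iInf_le_of_le hc le_rfl

/-- An infimum over no instances would be `⊤`; for `c ≤ 1` a single full point is an admissible
instance. -/
lemma pointSuccess_le_one {Δ : ℕ} {c : ℝ} (hc : c ≤ 1) (α : ℝ) (ps : PointSampler d Δ) :
    pointSuccess c α ps ≤ 1 :=
  (pointSuccess_le (R := {full fun _ => 0}) (Q := {full fun _ => 0}) α ps
    (Finset.singleton_nonempty _) (by simp [isMissing_full]) subset_rfl
    (by simpa using hc)).trans (toOuterMeasure_le_one _ _)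

lemma valueSuccess_le_one (hd : 0 < d) {c : ℝ} (hc : c ≤ 1) (α : ℝ) (vs : ValueSampler d) :
    valueSuccess c α vs ≤ 1 := by
  have hPD : PD {full fun _ => 0} {(⟨0, hd⟩ : Fin d)} = {full fun _ => 0} := by
    ext x
    simp only [mem_PD_singleton, Finset.mem_singleton, and_iff_left_iff_imp]
    rintro rfl
    simp [mem_dom, full]
  exact (valueSuccess_le (R := {full fun _ => 0}) (Q := {full fun _ => 0}) α vs ⟨0, hd⟩
    (Finset.singleton_nonempty _) subset_rfl (by rw [hPD]; simpa using hc)).trans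
    (toOuterMeasure_le_one _ _)

/-- The probability that all samples still needed for the partial center `u` are successful. -/
noncomputable def centerWeight (Δ : ℕ) (p q : ℝ≥0∞) (u : HPoint d) : ℝ≥0∞ :=
  if dom u = ∅ then p * q ^ Δ else q ^ (d - (dom u).card)

/-- The probability that all samples still needed for the partial centers are successful. -/
noncomputable def weight (Δ : ℕ) (p q : ℝ≥0∞) (U : Fin k → HPoint d) : ℝ≥0∞ :=
  ∏ t, centerWeight Δ p q (U t)

lemma weight_le_one {Δ : ℕ} {p q : ℝ≥0∞} (hp : p ≤ 1) (hq : q ≤ 1) (U : Fin k → HPoint d) :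
    weight Δ p q U ≤ 1 := by
  refine Finset.prod_le_one' fun t _ => ?_
  unfold centerWeight
  split_ifs
  · exact mul_le_one' hp (pow_le_one' hq _)
  · exact pow_le_one' hq _

lemma weight_update (Δ : ℕ) (p q : ℝ≥0∞) (U : Fin k → HPoint d) (t : Fin k) (u : HPoint d) :
    weight Δ p q (Function.update U t u) =
      centerWeight Δ p q u * ∏ t' ∈ Finset.univ.erase t, centerWeight Δ p q (U t') := by
  rw [weight, ← Finset.mul_prod_erase _ _ (Finset.mem_univ t), Function.update_self]
  congr 1
  exact Finset.prod_congr rfl fun t' ht' => by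
    rw [Function.update_of_ne (Finset.ne_of_mem_erase ht')]

/-- If the random choice of `v` for the center `U t` succeeds with probability at least `r` and
then leaves a weight of at least `w`, then the weight bounds the probability of the event `E`. -/
lemma weight_le_toOuterMeasure_bind {β γ : Type*} {Δ : ℕ} {p q r w : ℝ≥0∞}
    {U : Fin k → HPoint d} {t : Fin k} (μ : PMF β) (f : β → PMF γ) {S : Set β} {E : Set γ}
    (v : β → HPoint d) (hU : centerWeight Δ p q (U t) ≤ r * w) (hr : r ≤ μ.toOuterMeasure S)
    (hv : ∀ x, w ≤ centerWeight Δ p q (v x))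
    (hf : ∀ x ∈ S, weight Δ p q (Function.update U t (v x)) ≤ (f x).toOuterMeasure E) :
    weight Δ p q U ≤ (μ.bind f).toOuterMeasure E := by
  set rest := ∏ t' ∈ Finset.univ.erase t, centerWeight Δ p q (U t')
  calc weight Δ p q U = centerWeight Δ p q (U t) * rest := by
        rw [weight, ← Finset.mul_prod_erase _ _ (Finset.mem_univ t)]
    _ ≤ r * w * rest := by gcongr
    _ = r * (w * rest) := mul_assoc _ _ _
    _ ≤ μ.toOuterMeasure S * (w * rest) := by gcongr
    _ ≤ _ := toOuterMeasure_mul_le_bind μ f fun x hx => by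
        refine le_trans ?_ (hf x hx)
        rw [weight_update]
        exact mul_le_mul' (hv x) le_rfl

/-- A sampled point with fewer than `Δ` missing entries needs fewer value samples, which only helps
as `q ≤ 1`. -/
lemma pow_le_centerWeight_of_isMissing {Δ : ℕ} (hΔ : Δ < d) (p : ℝ≥0∞) {q : ℝ≥0∞} (hq : q ≤ 1)
    {v : HPoint d} (hv : IsMissing Δ v) : q ^ Δ ≤ centerWeight Δ p q v := by
  have := hv.le_card_dom_add
  rw [centerWeight, if_neg (hv.dom_nonempty hΔ).ne_empty]
  exact pow_le_pow_right_of_le_one' hq (by omega)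

lemma centerWeight_eq_mul_pow {Δ : ℕ} (p q : ℝ≥0∞) {u : HPoint d} (hu : dom u ≠ ∅)
    {j : Fin d} (hj : j ∉ dom u) :
    centerWeight Δ p q u = q * q ^ (d - (dom u).card - 1) := by
  have h1 : (dom u).card + 1 ≤ d := by
    rw [← Finset.card_insert_of_notMem hj]
    simpa using Finset.card_le_univ (insert j (dom u))
  rw [centerWeight, if_neg hu, ← pow_succ']
  congr 1
  omega

lemma centerWeight_update {Δ : ℕ} (p q : ℝ≥0∞) {u : HPoint d} {j : Fin d} (hj : j ∉ dom u)
    (x : ℝ) : centerWeight Δ p q (Function.update u j (some x)) = q ^ (d - (dom u).card - 1) := by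
  rw [centerWeight, dom_update, if_neg (Finset.insert_ne_empty _ _),
    Finset.card_insert_of_notMem hj, Nat.sub_sub]

lemma card_PD_le_sum (Q : Finset (HPoint d)) (I : Finset (Fin d)) :
    (PD Q I).card ≤ ∑ i ∈ I, (PD Q {i}).card := by
  refine le_trans (Finset.card_le_card fun x hx => ?_) Finset.card_biUnion_le
  obtain ⟨hxQ, i, hi⟩ := Finset.mem_filter.1 hx
  obtain ⟨hix, hiI⟩ := Finset.mem_inter.1 hi
  exact Finset.mem_biUnion.2 ⟨i, hiI, mem_PD_singleton.2 ⟨hxQ, hix⟩⟩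

/-! ### One phase and the whole loop -/

/-- `s'` is closer to termination than `s`. -/
def Progress (Δ : ℕ) (s s' : State k d) : Prop :=
  s'.R.card + totalRank Δ s.U < s.R.card + totalRank Δ s'.U

lemma progress_endOfSampling {Δ : ℕ} {s s' : State k d} {t : Fin k} {u : HPoint d}
    (hrank : rank Δ (s.U t) < rank Δ u)
    (he : EndOfSampling s (Function.update s.U t u) s') : Progress Δ s s' := by
  obtain ⟨a, -, rfl⟩ := he
  have h1 := totalRank_lt_update (U := s.U) hrank
  have h2 := Finset.card_le_card (Finset.sdiff_subset
    (s := s.R) (t := FD s.R (commonDom (Function.update s.U t u))))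
  simp only [Progress]
  omega

lemma EndOfSampling.centers_eq {s s' : State k d} {U : Fin k → HPoint d}
    (he : EndOfSampling s U s') : s'.U = U := by
  obtain ⟨a, -, rfl⟩ := he
  rfl

section

variable {Δ : ℕ} {α c : ℝ} {Pstar : Fin k → Finset (HPoint d)} {Cstar : Fin k → Fin d → ℝ}
  {τ : HPoint d → Fin k} {P : Finset (HPoint d)} {s : State k d}
  {ps : PointSampler d Δ} {vs : ValueSampler d} {μ : PMF (State k d)}

lemma progress_prune {B : Finset (HPoint d)} (hB : B ⊆ s.R) (hpos : 0 < B.card)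
    (a : HPoint d → Fin k) :
    Progress Δ s { R := s.R \ B, U := s.U, clusters := assign s.clusters B a } := by
  have := Finset.card_le_card hB
  simp only [Progress, Finset.card_sdiff_of_subset hB]
  omega

/-- A state of a run without unsuccessful samples. -/
def Successful (Δ : ℕ) (α c : ℝ) (Pstar : Fin k → Finset (HPoint d))
    (Cstar : Fin k → Fin d → ℝ) (τ : HPoint d → Fin k) (P : Finset (HPoint d))
    (s : State k d) : Prop :=
  ∃ G lam, Accounted Δ α (9 * (2 ^ k * c * (k - 1))) (5 * (2 ^ k * c * (k - 1)))
    Pstar Cstar τ P s G lam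

lemma Phase.valid_and_progress (hk : 1 ≤ k) (hΔ : Δ < d) (hτ : IsLabel P Pstar τ)
    (hc : 0 < c) (hc' : 4 * 2 ^ k * c * k ≤ 1)
    (h : Phase Pstar c ps vs s μ) (hs : Valid Δ P s) (hR : s.R.Nonempty) :
    ∀ s' ∈ μ.support, Valid Δ P s' ∧ Progress Δ s s' := by
  intro s' hs'
  cases h with
  | samplePoint t g ht hcard hI hg =>
    obtain ⟨u, -, rfl⟩ := (PMF.mem_support_map_iff _ _ _).1 hs'
    exact ⟨hs.endOfSampling u.2.le_card_dom_add (hg u),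
      progress_endOfSampling (rank_lt_of_dom_eq_empty hΔ hI u.2) (hg u)⟩
  | sampleValue t j g ht hcard hI hj hmax hg =>
    obtain ⟨x, -, rfl⟩ := (PMF.mem_support_map_iff _ _ _).1 hs'
    have hcen := (hs.centers t).resolve_left hI
    refine ⟨hs.endOfSampling ?_ (hg x), progress_endOfSampling (rank_lt_update hcen hI hj x) (hg x)⟩
    rw [dom_update, Finset.card_insert_of_notMem hj]
    omega
  | prune T B a hcount hT hmax hB ha =>
    rw [PMF.mem_support_pure_iff] at hs'
    subst hs'
    have hBR : B ⊆ s.R := fun x hx => (mem_cell.1 (hB.1 hx)).1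
    exact ⟨hs.prune hBR a,
      progress_prune hBR (prune_card_bounds hτ hs hR hc hk hc' hcount hmax hB ha).1 a⟩

/-- A successful sample uses up one factor of the weight; pruning is deterministic and keeps the
centers. -/
lemma Phase.weight_le_bind (hk : 1 ≤ k) (hΔ : Δ < d) (hP : ∀ x ∈ P, IsMissing Δ x)
    (hτ : IsLabel P Pstar τ) (hα : 0 < α) (hc : 0 < c) (hc' : 4 * 2 ^ k * c * k ≤ 1)
    (hq : valueSuccess (c / Δ) α vs ≤ 1)
    (h : Phase Pstar c ps vs s μ) (hs : Valid Δ P s) (hR : s.R.Nonempty)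
    (hsucc : Successful Δ α c Pstar Cstar τ P s) (f : State k d → PMF (State k d))
    (E : Set (State k d))
    (hf : ∀ s', Valid Δ P s' → Progress Δ s s' → Successful Δ α c Pstar Cstar τ P s' →
      weight Δ (pointSuccess c α ps) (valueSuccess (c / Δ) α vs) s'.U ≤
        (f s').toOuterMeasure E) :
    weight Δ (pointSuccess c α ps) (valueSuccess (c / Δ) α vs) s.U ≤
      (μ.bind f).toOuterMeasure E := by
  obtain ⟨G, lam, hacc⟩ := hsucc
  have hk1 : (0 : ℝ) ≤ k - 1 := by
    have : (1 : ℝ) ≤ k := by exact_mod_cast hk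
    linarith
  have hκ : (0 : ℝ) ≤ 5 * (2 ^ k * c * (k - 1)) := by positivity
  have hK : (0 : ℝ) ≤ 9 * (2 ^ k * c * (k - 1)) := by positivity
  cases h with
  | samplePoint t g ht hcard hI hg =>
    rw [PMF.bind_map]
    have hQ : c * (s.R.card : ℝ) ≤ ((s.R ∩ Pstar t).card : ℝ) :=
      hcard.trans (by exact_mod_cast Finset.card_le_card (Finset.filter_subset _ _))
    have hp := pointSuccess_le α ps hR (fun x hx => hP x (hs.rest_subset hx))
      Finset.inter_subset_left hQ
    refine weight_le_toOuterMeasure_bind (t := t) (w := valueSuccess (c / Δ) α vs ^ Δ) _ _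
      (fun u => u.1) (by simp [centerWeight, hI]) hp
      (fun u => pow_le_centerWeight_of_isMissing hΔ _ hq u.2) fun u hu => ?_
    rw [← (hg u).centers_eq]
    have hrank := rank_lt_of_dom_eq_empty hΔ hI u.2
    exact hf _ (hs.endOfSampling u.2.le_card_dom_add (hg u)) (progress_endOfSampling hrank (hg u))
      (hacc.endOfSampling hK hκ hs (extends_of_dom_eq_empty hI) hrank
        (hacc.near_point hΔ hP hτ hα hI hu) (hg u))
  | sampleValue t j g ht hcard hI hj hmax hg =>
    rw [PMF.bind_map]
    have hcen := (hs.centers t).resolve_left hI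
    -- At most `Δ` coordinates of the center are missing, so the best one, `j`, gets at least a `1 /
    -- Δ` share of the open points. For `Δ = 0` the quotient `c / Δ` is 0 and the bound is trivial.
    have hQ : c / Δ * (s.R.card : ℝ) ≤ ((PD (s.R ∩ Pstar t) {j}).card : ℝ) := by
      have h1 : openCount Pstar s t ≤ Δ * (PD (s.R ∩ Pstar t) {j}).card := by
        refine (card_PD_le_sum _ _).trans ((Finset.sum_le_card_nsmul _ _ _ fun i hi =>
          hmax i (Finset.mem_sdiff.1 hi).2).trans ?_)
        rw [smul_eq_mul, Finset.card_univ_sdiff, Fintype.card_fin]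
        gcongr
        omega
      have h2 : c * (s.R.card : ℝ) ≤ Δ * (PD (s.R ∩ Pstar t) {j}).card :=
        hcard.trans (by exact_mod_cast h1)
      rcases Nat.eq_zero_or_pos Δ with h0 | h0
      · simp [h0]
      · have : (0 : ℝ) < Δ := by exact_mod_cast h0
        rw [div_mul_eq_mul_div, div_le_iff₀ this]
        linarith
    have hp := valueSuccess_le α vs j hR Finset.inter_subset_left hQ
    refine weight_le_toOuterMeasure_bind (t := t) _ _
      (fun x => Function.update (s.U t) j (some x))
      (centerWeight_eq_mul_pow _ _ hI hj).le hp
      (fun x => (centerWeight_update _ _ hj x).ge) fun x hx => ?_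
    rw [← (hg x).centers_eq]
    have hrank := rank_lt_update hcen hI hj x
    refine hf _ (hs.endOfSampling ?_ (hg x)) (progress_endOfSampling hrank (hg x))
      (hacc.endOfSampling hK hκ hs (extends_update hj x) hrank
        (hacc.near_value hτ hα hj hx) (hg x))
    rw [dom_update, Finset.card_insert_of_notMem hj]
    omega
  | prune T B a hcount hT hmax hB ha =>
    have hBR : B ⊆ s.R := fun x hx => (mem_cell.1 (hB.1 hx)).1
    obtain ⟨hpos, h1, h2⟩ := prune_card_bounds hτ hs hR hc hk hc' hcount hmax hB ha
    rw [PMF.pure_bind]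
    exact hf _ (hs.prune hBR a) (progress_prune hBR hpos a)
      (hacc.prune (by linarith) hκ hs hB ha h1 h2)

lemma loop_of_rest_eq_empty (next : State k d → PMF (State k d)) (n : ℕ) (h : s.R = ∅) :
    loop next n s = PMF.pure s := by
  cases n <;> simp [loop, h]

lemma rest_eq_empty_of_bound (hn : k * (Δ + 1) + s.R.card ≤ 0 + totalRank Δ s.U) :
    s.R = ∅ := by
  have := totalRank_le Δ s.U
  rw [← Finset.card_eq_zero]
  omega

/-- The hypothesis `hn` says that the `n` remaining phases cover the unassigned points and the rank
still to be gained; `Progress` preserves it. -/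
lemma loop_terminates (hk : 1 ≤ k) (hΔ : Δ < d) (hτ : IsLabel P Pstar τ)
    (hc : 0 < c) (hc' : 4 * 2 ^ k * c * k ≤ 1) {next : State k d → PMF (State k d)}
    (hnext : IsPhaseRule Pstar c ps vs next) (n : ℕ) (s : State k d) (hs : Valid Δ P s)
    (hn : k * (Δ + 1) + s.R.card ≤ n + totalRank Δ s.U) :
    ∀ s' ∈ (loop next n s).support, s'.R = ∅ := by
  induction n generalizing s with
  | zero =>
    intro s' hs'
    rw [loop, PMF.mem_support_pure_iff] at hs'
    exact hs' ▸ rest_eq_empty_of_bound hn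
  | succ n ih =>
    intro s' hs'
    by_cases hR : s.R = ∅
    · rw [loop_of_rest_eq_empty _ _ hR, PMF.mem_support_pure_iff] at hs'
      exact hs' ▸ hR
    · have hRne := Finset.nonempty_iff_ne_empty.2 hR
      have hphase := hnext s hRne (exists_phase hk hτ hc hc' ps vs hs hRne)
      rw [loop, if_neg hR, PMF.mem_support_bind_iff] at hs'
      obtain ⟨s₁, hs₁, hs'⟩ := hs'
      obtain ⟨hv, hp⟩ := hphase.valid_and_progress hk hΔ hτ hc hc' hs hRne s₁ hs₁
      refine ih s₁ hv ?_ s' hs'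
      unfold Progress at hp
      omega

lemma weight_le_loop (hk : 1 ≤ k) (hΔ : Δ < d) (hP : ∀ x ∈ P, IsMissing Δ x)
    (hτ : IsLabel P Pstar τ) (hα : 0 < α) (hc : 0 < c) (hc' : 4 * 2 ^ k * c * k ≤ 1)
    (hp : pointSuccess c α ps ≤ 1) (hq : valueSuccess (c / Δ) α vs ≤ 1)
    {next : State k d → PMF (State k d)} (hnext : IsPhaseRule Pstar c ps vs next) (n : ℕ)
    (s : State k d) (hs : Valid Δ P s) (hsucc : Successful Δ α c Pstar Cstar τ P s)
    (hn : k * (Δ + 1) + s.R.card ≤ n + totalRank Δ s.U) :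
    weight Δ (pointSuccess c α ps) (valueSuccess (c / Δ) α vs) s.U ≤
      (loop next n s).toOuterMeasure
        {s' | s'.R = ∅ ∧ Valid Δ P s' ∧ Successful Δ α c Pstar Cstar τ P s'} := by
  -- The loop may end before all entries are sampled; the event is then certain, and the leftover
  -- weight is at most 1.
  have hdone : ∀ m s, Valid Δ P s → Successful Δ α c Pstar Cstar τ P s → s.R = ∅ →
      weight Δ (pointSuccess c α ps) (valueSuccess (c / Δ) α vs) s.U ≤
        (loop next m s).toOuterMeasure
          {s' | s'.R = ∅ ∧ Valid Δ P s' ∧ Successful Δ α c Pstar Cstar τ P s'} := by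
    intro m s hs hsucc hR
    rw [loop_of_rest_eq_empty _ _ hR]
    refine (weight_le_one hp hq _).trans (le_of_eq ?_)
    rw [eq_comm, PMF.toOuterMeasure_apply_eq_one_iff, PMF.support_pure,
      Set.singleton_subset_iff]
    exact ⟨hR, hs, hsucc⟩
  induction n generalizing s with
  | zero => exact hdone 0 s hs hsucc (rest_eq_empty_of_bound hn)
  | succ n ih =>
    by_cases hR : s.R = ∅
    · exact hdone _ s hs hsucc hR
    · have hRne := Finset.nonempty_iff_ne_empty.2 hR
      have hphase := hnext s hRne (exists_phase hk hτ hc hc' ps vs hs hRne)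
      rw [loop, if_neg hR]
      refine hphase.weight_le_bind hk hΔ hP hτ hα hc hc' hq hs hRne hsucc _ _
        fun s₁ hv hprog hsucc₁ => ih s₁ hv hsucc₁ ?_
      unfold Progress at hprog
      omega

end

end MissingKMeans

theorem lemma5 {d k Δ : ℕ} (hk : 1 ≤ k) (hΔ : Δ < d)
    (P : Finset (HPoint d)) (hP : ∀ x ∈ P, IsMissing Δ x)
    (Pstar : Fin k → Finset (HPoint d)) (Cstar : Fin k → Fin d → ℝ)
    (hopt : IsOptimalKMeans P Pstar Cstar)
    (α c : ℝ) (hα : 0 < α) (hc : 0 < c) (hc' : 4 * 2 ^ k * c * k ≤ 1)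
    (ps : PointSampler d Δ) (vs : ValueSampler d)
    (next : State k d → PMF (State k d)) (hnext : IsPhaseRule Pstar c ps vs next)
    (n : ℕ) (hn : k * (Δ + 1) + P.card ≤ n) :
    (∀ s ∈ (loop next n (initState k P)).support, s.R = ∅) ∧
    pointSuccess c α ps ^ k * valueSuccess (c / Δ) α vs ^ (k * Δ) ≤
      (loop next n (initState k P)).toOuterMeasure
        {s | ∀ C, Completes s.U C →
          IsApproxKMeans ((1 + 8 * 2 ^ k * c * k ^ 2 * (Δ + 1) ^ 2) * (1 + α)) P
            s.clusters C} := by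
  obtain ⟨τ, hτ⟩ := hopt.1.exists_isLabel hk
  have hv := valid_initState hk hΔ hP
  have hn' : k * (Δ + 1) + (initState k P).R.card ≤ n + totalRank Δ (initState k P).U :=
    hn.trans (Nat.le_add_right _ _)
  refine ⟨loop_terminates hk hΔ hτ hc hc' hnext n _ hv hn', ?_⟩
  have hk1 : (1 : ℝ) ≤ k := by exact_mod_cast hk
  have hc1 : c ≤ 1 := by
    have h1 : (1 : ℝ) ≤ 2 ^ k := one_le_pow₀ (by norm_num)
    have h2 : 1 * 1 ≤ (2 : ℝ) ^ k * k := mul_le_mul h1 hk1 zero_le_one (by positivity)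
    nlinarith
  have hcΔ : c / Δ ≤ 1 := by
    rcases Nat.eq_zero_or_pos Δ with h0 | h0
    · simp [h0]
    · have : (1 : ℝ) ≤ Δ := by exact_mod_cast h0
      exact (div_le_self hc.le this).trans hc1
  have hw := weight_le_loop hk hΔ hP hτ (Cstar := Cstar) hα hc hc'
    (pointSuccess_le_one hc1 α ps) (valueSuccess_le_one (by omega) hcΔ α vs) hnext n _ hv
    ⟨_, _, accounted_initState⟩ hn'
  have hw0 : weight Δ (pointSuccess c α ps) (valueSuccess (c / Δ) α vs) (initState k P).U =
      pointSuccess c α ps ^ k * valueSuccess (c / Δ) α vs ^ (k * Δ) := by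
    simp [weight, centerWeight, initState, dom_nullPoint, mul_pow, ← pow_mul, mul_comm]
  rw [← hw0]
  refine hw.trans ((loop next n (initState k P)).toOuterMeasure.mono ?_)
  rintro s ⟨hR, hs, G, lam, hacc⟩ C hC
  exact hacc.isApproxKMeans hk hα hc hopt hτ hs hR hC
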